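/- For a finite group $G$, let $d(G)$ be its minimum number of generators. A spherical system of generators of $G$ of size $r$ is a tuple $T=(g_1,\dots,g_r)$ of non-trivial elements with $\langle g_1,\dots,g_r\rangle=G$ and $g_1g_2\cdots g_r=1$; put $\Sigma(T)=\bigcup_{g\in G}\bigcup_{i=1}^r \langle g_i\rangle^g$. A ramification structure of size $(r_1,r_2)$ for $G$ is a pair $(T_1,T_2)$ of spherical systems of generators of $G$, of sizes $r_1$ and $r_2$, with $\Sigma(T_1)\cap\Sigma(T_2)=\{1\}$. Theorem A. Let $p$ be a prime, let $G$ be a finite $p$-group of exponent $p^e$, and let $d=d(G)$. (If $G$ is trivial, so that $e=0$, read $p^{e-1}$ as $1$.) Suppose that $G$ is semi-$p^{e-1}$-abelian, that is, for all $x,y\in G$, $x^{p^{e-1}}=y^{p^{e-1}}$ if and only if $(xy^{-1})^{p^{e-1}}=1$. Then $G$ admits a ramification structure if and only if $|\{g^{p^{e-1}}\mid g\in G\}|\ge p^s$, where $s=2$ if $p\ge 3$ and $s=3$ if $p=2$. In that case, $G$ admits a ramification structure of size $(r_1,r_2)$ if and only if the following conditions hold: (i) $r_1,r_2\ge d+1$;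 (ii) if $p=3$, then $r_1,r_2\ge 4$; (iii) if $p=2$, then $r_1,r_2\ge 5$; (iv) if $p=2$ and $|\{g^{2^{e-1}}\mid g\in G\}|=2^3$, then $(r_1,r_2)\ne(5,5)$, and furthermore, if $e=1$, then $r_1,r_2$ are not both odd. Moreover, when $p=2$ and $|\{g^{2^{e-1}}\mid g\in G\}|=2^3$, one has $e=1$ if and only if $G\cong C_2\times C_2\times C_2$. -/

import Mathlib

/-- `T = (g₁, …, g_r)` is a spherical system of generators of `G`: a tuple of non-trivial elements
that generate `G` and satisfy `g₁ g₂ ⋯ g_r = 1`. -/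
structure IsSphericalSystem {G : Type*} [Group G] (T : List G) : Prop where
  ne_one : ∀ x ∈ T, x ≠ 1
  closure_eq_top : Subgroup.closure {x | x ∈ T} = ⊤
  prod_eq_one : T.prod = 1

/-- `Σ(T)`: the union of all conjugates `g⁻¹ ⟨x⟩ g` of the cyclic subgroups generated by the
members `x` of `T`. -/
def sigmaSet {G : Type*} [Group G] (T : List G) : Set G :=
  ⋃ g : G, ⋃ x ∈ T, {y | ∃ z ∈ Subgroup.zpowers x, y = g⁻¹ * z * g}

/-- `(T₁, T₂)` is an (unmixed) ramification structure for `G`: both are spherical systems of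
generators, and they are disjoint, i.e. `Σ(T₁) ∩ Σ(T₂) = 1`. -/
structure IsRamificationStructure {G : Type*} [Group G] (T₁ T₂ : List G) : Prop where
  spherical_left : IsSphericalSystem T₁
  spherical_right : IsSphericalSystem T₂
  disjoint : sigmaSet T₁ ∩ sigmaSet T₂ = {1}

/-- `S(G)`: the set of all sizes `(r₁, r₂)` of ramification structures of `G`. -/
def ramificationSizes (G : Type*) [Group G] : Set (ℕ × ℕ) :=
  {r | ∃ T₁ T₂ : List G, IsRamificationStructure T₁ T₂ ∧ T₁.length = r.1 ∧ T₂.length = r.2}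

/-- `G` is semi-`p ^ i`-abelian: `x ^ (p ^ i) = y ^ (p ^ i)` if and only if
`(x y⁻¹) ^ (p ^ i) = 1`, for all `x, y ∈ G`. -/
def IsSemiPowAbelian (p i : ℕ) (G : Type*) [Group G] : Prop :=
  ∀ x y : G, x ^ p ^ i = y ^ p ^ i ↔ (x * y⁻¹) ^ p ^ i = 1

/-- The set `{g ^ (p ^ i) | g ∈ G}` (not the subgroup it generates). -/
def powSet (p i : ℕ) (G : Type*) [Group G] : Set G :=
  Set.range fun g : G => g ^ p ^ i

/-! Write q = p ^ (e - 1). The hypothesis makes K = {x | x ^ q = 1} a normal subgroup whose cosets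
are the fibres of x ↦ x ^ q. So G/K has as many elements as there are q-th powers, and its exponent
divides p. An element x outside K has order p ^ e, and the elements of order p in ⟨x⟩ are q-th
powers of elements x ^ k with p ∤ k. Disjointness can therefore be tested on images in a quotient of
G/K.

Sufficiency: map G onto an elementary abelian group U of rank 2 (p odd) or 3 or 4 (p = 2), killing
K. Explicit spherical systems of U with pairwise independent members
(`exists_isSphericalSystem_plane`, `exists_isSphericalSystem_four`,
`exists_isSphericalSystem_three`) lift to G by Gaschütz's lemma (`card_lifts_closure_eq`,
`exists_list_lift`), and disjointness survives by `orderOf_ne_of_independent`. For p = 2 with eight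
powers and both sizes odd, one list must also contain an element w ≠ 1 mapping to 1. The only
involution of ⟨w⟩ is a q-th power for at most one value of f on the roots, and the other list avoids
that value (`mem_ramificationSizes_of_odd_odd`).

Necessity: members of the two lists cannot share a non-trivial image in G/K, even up to powers and
conjugation. If p = 2 then G/K = C_2 ^ m, and two disjoint generating sets of non-trivial vectors
need 2m ≤ 2 ^ m - 1. For m = 3 one of them is a basis, and a product of basis vectors is trivial
only if each occurs evenly often (`even_count_of_card_le_rank`). If p = 3, a list of size 3 fails
because in a non-cyclic group of exponent 3 generated by x and y, every generating set has a member
with a power conjugate to x, y or (x y)⁻¹ (`exists_conj_of_pow_three`). -/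

/-! ### Gaschütz's lemma and lifting of generating lists -/

open scoped Classical in
/-- The number of tuples `y` lifting a generating tuple `h` of `U`
with `⟨y, W⟩ = C` does not depend on `h`. -/
theorem card_lifts_closure_eq {G U : Type*} [Group G] [Group U] [Finite G] (f : G →* U)
    (W : Set G) {n : ℕ} (C : Subgroup G) (h h' : Fin n → U)
    (hh : Subgroup.closure (Set.range h) = ⊤) (hh' : Subgroup.closure (Set.range h') = ⊤) :
    Nat.card {y : Fin n → G // f ∘ y = h ∧ Subgroup.closure (Set.range y ∪ W) = C} =
      Nat.card {y : Fin n → G // f ∘ y = h' ∧ Subgroup.closure (Set.range y ∪ W) = C} := by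
  induction C using WellFoundedLT.induction with
  | _ C ih =>
  have key : ∀ k : Fin n → U, Subgroup.closure (Set.range k) = ⊤ → ∀ y : Fin n → G, f ∘ y = k →
      Subgroup.closure (Set.range y ∪ W) = C → W ⊆ C ∧ C.map f = ⊤ := by
    intro k hk y hy hC
    refine ⟨?_, ?_⟩
    · rw [← hC]
      exact Set.subset_union_right.trans Subgroup.subset_closure
    · rw [eq_top_iff, ← hk, Subgroup.closure_le]
      rintro _ ⟨i, rfl⟩
      refine ⟨y i, ?_, congrFun hy i⟩
      rw [← hC]
      exact Subgroup.subset_closure (Or.inl ⟨i, rfl⟩)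
  by_cases hCW : W ⊆ C ∧ C.map f = ⊤
  swap
  · rw [Nat.card_eq_zero.2 (Or.inl ⟨fun y => hCW (key h hh y.1 y.2.1 y.2.2)⟩),
      Nat.card_eq_zero.2 (Or.inl ⟨fun y => hCW (key h' hh' y.1 y.2.1 y.2.2)⟩)]
  obtain ⟨hWC, hmap⟩ := hCW
  have hc : ∀ i, ∃ c ∈ C, f c = h' i * (h i)⁻¹ := by
    intro i
    have : h' i * (h i)⁻¹ ∈ C.map f := by rw [hmap]; trivial
    exact this
  choose c hcC hfc using hc
  -- Translation by `c`, whose entries lie in `C`, carries lifts of `h` inside `C` to lifts of `h'`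
  -- inside `C`. Sorting these lifts by the subgroup they generate with `W`, induction removes all
  -- proper subgroups of `C`.
  have total : Nat.card {y : Fin n → G // f ∘ y = h ∧ Subgroup.closure (Set.range y ∪ W) ≤ C} =
      Nat.card {y : Fin n → G // f ∘ y = h' ∧ Subgroup.closure (Set.range y ∪ W) ≤ C} := by
    have hle : ∀ y : Fin n → G, Subgroup.closure (Set.range y ∪ W) ≤ C ↔ ∀ i, y i ∈ C := by
      intro y
      rw [Subgroup.closure_le, Set.union_subset_iff, Set.range_subset_iff]
      exact ⟨fun hy => hy.1, fun hy => ⟨hy, hWC⟩⟩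
    refine Nat.card_congr ((Equiv.mulLeft c).subtypeEquiv fun y => ?_)
    simp only [hle, Equiv.coe_mulLeft, Pi.mul_apply, funext_iff, Function.comp_apply, map_mul, hfc]
    refine and_congr (forall_congr' fun i => ?_) (forall_congr' fun i => ?_)
    · constructor
      · rintro hi
        simp [hi]
      · intro hi
        rw [mul_assoc] at hi
        exact (inv_mul_eq_one.1 (mul_eq_left.1 hi)).symm
    · exact (C.mul_mem_cancel_left (hcC i)).symm
  have split : ∀ k : Fin n → U,
      Nat.card {y : Fin n → G // f ∘ y = k ∧ Subgroup.closure (Set.range y ∪ W) ≤ C} =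
      ∑ᶠ B : Set.Iic C,
        Nat.card {y : Fin n → G // f ∘ y = k ∧ Subgroup.closure (Set.range y ∪ W) = B} := by
    intro k
    have := Fintype.ofFinite (Set.Iic C)
    rw [finsum_eq_sum_of_fintype, ← Nat.card_sigma]
    refine Nat.card_congr ⟨fun y => ⟨⟨_, y.2.2⟩, y.1, y.2.1, rfl⟩,
      fun z => ⟨z.2.1, z.2.2.1, z.2.2.2.le.trans z.1.2⟩, fun y => rfl, ?_⟩
    rintro ⟨⟨B, hB⟩, y, hy, hyB⟩
    change Subgroup.closure _ = B at hyB
    subst hyB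
    rfl
  have := Fintype.ofFinite (Set.Iic C)
  rw [split, split, finsum_eq_sum_of_fintype, finsum_eq_sum_of_fintype,
    ← Finset.add_sum_erase _ _ (Finset.mem_univ (⟨C, Set.self_mem_Iic⟩ : Set.Iic C)),
    ← Finset.add_sum_erase _ _ (Finset.mem_univ (⟨C, Set.self_mem_Iic⟩ : Set.Iic C)),
    Finset.sum_congr rfl fun B hB => ih B.1 (lt_of_le_of_ne B.2 fun hBC =>
      (Finset.mem_erase.1 hB).1 (Subtype.ext hBC))] at total
  exact Nat.add_right_cancel total

/-- Gaschütz's lemma, relative to a subset `W` of the kernel: generating tuples lift. -/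
theorem exists_lift_closure_eq_top {G U : Type*} [Group G] [Group U] [Finite G] {f : G →* U}
    (hf : Function.Surjective f) {W : Set G} (hW : W ⊆ f.ker) {n : ℕ} {x : Fin n → G}
    (hx : Subgroup.closure (Set.range x ∪ W) = ⊤) {h : Fin n → U}
    (hh : Subgroup.closure (Set.range h) = ⊤) :
    ∃ y : Fin n → G, f ∘ y = h ∧ Subgroup.closure (Set.range y ∪ W) = ⊤ := by
  have hfx : Subgroup.closure (Set.range (f ∘ x)) = ⊤ := by
    rw [eq_top_iff, ← Subgroup.map_top_of_surjective f hf, ← hx, MonoidHom.map_closure,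
      Subgroup.closure_le]
    rintro _ ⟨_, ⟨i, rfl⟩ | hw, rfl⟩
    · exact Subgroup.subset_closure ⟨i, rfl⟩
    · rw [MonoidHom.mem_ker.1 (hW hw)]
      exact one_mem _
  have hpos : 0 < Nat.card
      {y : Fin n → G // f ∘ y = f ∘ x ∧ Subgroup.closure (Set.range y ∪ W) = ⊤} :=
    Nat.card_pos_iff.2 ⟨⟨x, rfl, hx⟩, inferInstance⟩
  rw [card_lifts_closure_eq f W ⊤ _ h hfx hh] at hpos
  obtain ⟨⟨y, hy⟩⟩ := (Nat.card_pos_iff.1 hpos).1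
  exact ⟨y, hy⟩

/-- A group of rank at most `n` is generated by some `n`-tuple. -/
theorem exists_closure_range_eq_top {G : Type*} [Group G] [Finite G] {n : ℕ}
    (hn : Group.rank G ≤ n) : ∃ x : Fin n → G, Subgroup.closure (Set.range x) = ⊤ := by
  obtain ⟨S, hS, hS'⟩ := Group.rank_spec G
  let g := S.equivFin.symm
  refine ⟨fun i => if h : (i : ℕ) < S.card then g ⟨i, h⟩ else 1, ?_⟩
  rw [eq_top_iff, ← hS', Subgroup.closure_le]
  intro s hs
  refine Subgroup.subset_closure ⟨⟨S.equivFin ⟨s, hs⟩, (S.equivFin ⟨s, hs⟩).2.trans_le (hS ▸ hn)⟩, ?_⟩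
  simp [g]

/-- The head is the inverse of the product of the tail. This redundancy is the source of the bound d
+ 1 on sizes. -/
theorem closure_range_get_tail_eq_top {U : Type*} [Group U] {l : U} {L : List U}
    (hprod : (l :: L).prod = 1) (hL : Subgroup.closure {u | u ∈ l :: L} = ⊤) :
    Subgroup.closure (Set.range L.get) = ⊤ := by
  rw [eq_top_iff, ← hL, Subgroup.closure_le]
  intro u hu
  have hsub : ∀ v ∈ L, v ∈ Subgroup.closure (Set.range L.get) := fun v hv =>
    Subgroup.subset_closure (by simpa using hv)
  rcases List.mem_cons.1 hu with rfl | hu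
  · rw [List.prod_cons, mul_eq_one_iff_eq_inv] at hprod
    rw [hprod]
    exact inv_mem (Subgroup.list_prod_mem _ hsub)
  · exact hsub u hu

/-- A list with trivial product that generates `U` lifts along `f : G → U` to a list of elements of
`G` which, together with the prescribed elements `ws` of the kernel, generates `G` and has trivial
product. -/
theorem exists_list_lift {G U : Type*} [Group G] [Group U] [Finite G] {f : G →* U}
    (hf : Function.Surjective f) {ws : List G} (hws : ∀ w ∈ ws, f w = 1) {l : U} {L : List U}
    (hprod : (l :: L).prod = 1) (hL : Subgroup.closure {u | u ∈ l :: L} = ⊤)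
    {x : Fin L.length → G} (hx : Subgroup.closure (Set.range x ∪ {w | w ∈ ws}) = ⊤) :
    ∃ T : List G, T.map f = l :: L ∧ Subgroup.closure {g | g ∈ ws ++ T} = ⊤ ∧
      (ws ++ T).prod = 1 := by
  have hL' := closure_range_get_tail_eq_top hprod hL
  obtain ⟨y, hy, hy'⟩ := exists_lift_closure_eq_top hf (W := {w | w ∈ ws}) (fun w hw => hws w hw)
    hx hL'
  have hmap : (List.ofFn y).map f = L := by
    rw [List.map_ofFn, hy, List.ofFn_get]
  have hwsf : f ws.prod = 1 := by
    rw [map_list_prod]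
    refine List.prod_eq_one fun u hu => ?_
    obtain ⟨w, hw, rfl⟩ := List.mem_map.1 hu
    exact hws w hw
  -- Only the tail is lifted by Gaschütz; the head is then forced by the product, and maps to `l`
  -- because `ws` maps to 1.
  refine ⟨(ws.prod⁻¹ * (List.ofFn y).prod⁻¹) :: List.ofFn y, ?_, ?_, ?_⟩
  · rw [List.map_cons, hmap, map_mul, map_inv, map_inv, hwsf, map_list_prod, hmap]
    rw [List.prod_cons, mul_eq_one_iff_eq_inv] at hprod
    simp [hprod]
  · rw [eq_top_iff, ← hy', Subgroup.closure_le]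
    rintro g (⟨i, rfl⟩ | hg) <;> refine Subgroup.subset_closure ?_
    · simp
    · simpa using Or.inl hg
  · simp

/-! ### The kernel of the power map and its quotient -/

/-- The elements killed by `p ^ i` form a subgroup of a semi-`p ^ i`-abelian group. -/
def IsSemiPowAbelian.powKer {p i : ℕ} {G : Type*} [Group G] (h : IsSemiPowAbelian p i G) :
    Subgroup G where
  carrier := {x | x ^ p ^ i = 1}
  one_mem' := one_pow _
  mul_mem' {a b} ha hb := by
    have := (h a b⁻¹).1 (by rw [inv_pow, ha, hb, inv_one])
    rwa [inv_inv] at this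
  inv_mem' {a} ha := by
    change a⁻¹ ^ p ^ i = 1
    rw [inv_pow, ha, inv_one]

namespace IsSemiPowAbelian

variable {p i : ℕ} {G : Type*} [Group G] (h : IsSemiPowAbelian p i G)

theorem mem_powKer {x : G} : x ∈ h.powKer ↔ x ^ p ^ i = 1 := Iff.rfl

instance normal_powKer : h.powKer.Normal :=
  ⟨fun x hx g => by rw [mem_powKer] at *; rw [conj_pow, hx, mul_one, mul_inv_cancel]⟩

/-- The semi-abelian condition read in the quotient: the power map factors through it injectively.
-/
theorem mk_eq_mk_iff {x y : G} : (x : G ⧸ h.powKer) = y ↔ x ^ p ^ i = y ^ p ^ i := by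
  rw [h x y, ← div_eq_mul_inv]
  exact QuotientGroup.eq_iff_div_mem

theorem card_quotient_powKer : Nat.card (G ⧸ h.powKer) = (powSet p i G).ncard := by
  refine Nat.card_congr (Equiv.ofBijective
    (fun x => Quotient.liftOn' x (fun g => (⟨g ^ p ^ i, g, rfl⟩ : powSet p i G)) ?_) ⟨?_, ?_⟩)
  · intro a b hab
    exact Subtype.ext (h.mk_eq_mk_iff.1 (Quotient.sound' hab))
  · intro a b
    induction a using QuotientGroup.induction_on
    induction b using QuotientGroup.induction_on
    intro hab
    exact h.mk_eq_mk_iff.2 (congrArg Subtype.val hab)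
  · rintro ⟨_, g, rfl⟩
    exact ⟨(g : G ⧸ h.powKer), rfl⟩

theorem quotient_pow_eq_one (hexp : Monoid.exponent G ∣ p ^ (i + 1)) (x : G ⧸ h.powKer) :
    x ^ p = 1 := by
  induction x using QuotientGroup.induction_on with
  | H x =>
    rw [← QuotientGroup.mk_pow, QuotientGroup.eq_one_iff, mem_powKer, ← pow_mul, ← pow_succ']
    exact Monoid.exponent_dvd_iff_forall_pow_eq_one.1 hexp x

end IsSemiPowAbelian

/-! ### Elementary abelian quotients -/

/-- A finite commutative group of exponent `p` and order at least `p ^ m` maps onto `C_p ^ m`. -/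
theorem exists_surjective_of_comm {p : ℕ} [Fact p.Prime] {H : Type*} [Group H] [Finite H]
    (hcomm : ∀ a b : H, a * b = b * a) (hp : ∀ x : H, x ^ p = 1) {m : ℕ}
    (hcard : p ^ m ≤ Nat.card H) :
    ∃ f : H →* Multiplicative (Fin m → ZMod p), Function.Surjective f := by
  let _ : CommGroup H := { (inferInstance : Group H) with mul_comm := hcomm }
  let _ : Module (ZMod p) (Additive H) := AddCommGroup.zmodModule (n := p) fun x => hp x.toMul
  have hk : Nat.card (Additive H) = p ^ Module.finrank (ZMod p) (Additive H) := by
    rw [Module.natCard_eq_pow_finrank (K := ZMod p), Nat.card_zmod]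
  have hmk : m ≤ Module.finrank (ZMod p) (Additive H) :=
    (Nat.pow_le_pow_iff_right (Fact.out : p.Prime).one_lt).1 (hk ▸ hcard)
  let g : Additive H →ₗ[ZMod p] (Fin m → ZMod p) :=
    (LinearMap.funLeft (ZMod p) (ZMod p) (Fin.castLE hmk)) ∘ₗ
      (Module.finBasis (ZMod p) (Additive H)).equivFun.toLinearMap
  have hg : Function.Surjective g :=
    (LinearMap.funLeft_surjective_of_injective (ZMod p) (ZMod p) _ (Fin.castLE_injective hmk)).comp
      (Module.finBasis (ZMod p) (Additive H)).equivFun.surjective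
  exact ⟨AddMonoidHom.toMultiplicativeRight g.toAddMonoidHom, hg⟩

/-- A finite group of exponent `p` and order at least `p ^ 2` maps onto `C_p × C_p`. -/
theorem exists_surjective_two {p : ℕ} [Fact p.Prime] {H : Type*} [Group H] [Finite H]
    (hp : ∀ x : H, x ^ p = 1) (hcard : p ^ 2 ≤ Nat.card H) :
    ∃ f : H →* Multiplicative (Fin 2 → ZMod p), Function.Surjective f := by
  induction hn : Nat.card H using Nat.strong_induction_on generalizing H with
  | _ n ih =>
  have hpr : p.Prime := Fact.out
  have hH : IsPGroup p H := fun x => ⟨1, by rw [pow_one, hp]⟩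
  by_cases hcomm : ∀ a b : H, a * b = b * a
  · exact exists_surjective_of_comm hcomm hp hcard
  have : Nontrivial H := Finite.one_lt_card_iff_nontrivial.1
    ((Nat.one_lt_pow two_ne_zero hpr.one_lt).trans_le hcard)
  have hZ := hH.center_nontrivial
  have hQp : ∀ x : H ⧸ Subgroup.center H, x ^ p = 1 := fun x => by
    induction x using QuotientGroup.induction_on with
    | H x => rw [← QuotientGroup.mk_pow, hp, QuotientGroup.mk_one]
  have hQlt : Nat.card (H ⧸ Subgroup.center H) < n := by
    rw [← hn, Subgroup.card_eq_card_quotient_mul_card_subgroup (Subgroup.center H)]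
    exact (lt_mul_iff_one_lt_right Nat.card_pos).2 Finite.one_lt_card
  -- A cyclic quotient by the centre would make `H` commutative, so factoring out the centre leaves
  -- order at least p ^ 2.
  have hQcard : p ^ 2 ≤ Nat.card (H ⧸ Subgroup.center H) := by
    obtain ⟨k, hk⟩ := (IsPGroup.iff_card (p := p)).1 (hH.to_quotient (Subgroup.center H))
    rw [hk]
    refine Nat.pow_le_pow_right hpr.pos ?_
    by_contra! hk2
    refine hcomm ?_
    have : IsCyclic (H ⧸ Subgroup.center H) := by
      interval_cases k
      · have := Finite.card_le_one_iff_subsingleton.1 (hk.trans (pow_zero p)).le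
        infer_instance
      · exact isCyclic_of_prime_card (hk.trans (pow_one p))
    exact (MonoidHom.isMulCommutative_of_isCyclic_of_ker_le_center
      (QuotientGroup.mk' (Subgroup.center H)) (QuotientGroup.ker_mk' _).le).is_comm.comm
  obtain ⟨f, hf⟩ := ih _ hQlt hQp hQcard rfl
  exact ⟨f.comp (QuotientGroup.mk' _), hf.comp (QuotientGroup.mk'_surjective _)⟩

/-- Any nonzero vector can be moved to any other by a linear automorphism. -/
theorem exists_linearEquiv_apply_eq {K V : Type*} [Field K] [AddCommGroup V] [Module K V]
    [FiniteDimensional K V] {x y : V} (hx : x ≠ 0) (hy : y ≠ 0) : ∃ g : V ≃ₗ[K] V, g x = y := by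
  obtain ⟨g, hg⟩ := Submodule.exists_linearEquiv_restrict_eq
    ((LinearEquiv.toSpanNonzeroSingleton K V x hx).symm ≪≫ₗ
      LinearEquiv.toSpanNonzeroSingleton K V y hy)
  refine ⟨g, ?_⟩
  have := hg (LinearEquiv.toSpanNonzeroSingleton K V x hx 1)
  rw [LinearEquiv.trans_apply, LinearEquiv.symm_apply_apply] at this
  simpa using this.symm

namespace IsSemiPowAbelian

variable {p e : ℕ} {G : Type*} [Group G] [Finite G]

/-- `G` maps onto `C_p ^ m`, with kernel containing all `x` with `x ^ p ^ (e - 1) = 1`, when there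
are enough `p ^ (e - 1)`-th powers. -/
theorem exists_surjective [hp : Fact p.Prime] (h : IsSemiPowAbelian p (e - 1) G)
    (hexp : Monoid.exponent G = p ^ e) {m : ℕ} (hm : m = 2 ∨ p = 2)
    (hcard : p ^ m ≤ (powSet p (e - 1) G).ncard) :
    ∃ f : G →* Multiplicative (Fin m → ZMod p), Function.Surjective f ∧
      ∀ x, x ^ p ^ (e - 1) = 1 → f x = 1 := by
  have hpow := h.quotient_pow_eq_one (hexp ▸ pow_dvd_pow p (by omega))
  rw [← h.card_quotient_powKer] at hcard
  suffices ∃ f : G ⧸ h.powKer →* Multiplicative (Fin m → ZMod p), Function.Surjective f by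
    obtain ⟨f, hf⟩ := this
    refine ⟨f.comp (QuotientGroup.mk' _), hf.comp (QuotientGroup.mk'_surjective _),
      fun x hx => ?_⟩
    rw [MonoidHom.comp_apply, QuotientGroup.mk'_apply, (QuotientGroup.eq_one_iff x).2 hx, map_one]
  rcases hm with rfl | rfl
  · exact exists_surjective_two hpow hcard
  · refine exists_surjective_of_comm ?_ hpow hcard
    intro a b
    have hinv : ∀ x : G ⧸ h.powKer, x⁻¹ = x := fun x =>
      inv_eq_of_mul_eq_one_left (by rw [← sq, hpow])
    rw [← hinv (a * b), mul_inv_rev, hinv, hinv]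

/-- If there are exactly `2 ^ m` powers, the kernel of a surjection to `C_2 ^ m` is as small as
possible. -/
theorem pow_eq_pow_of_apply_eq [hp : Fact p.Prime] {i : ℕ} (h : IsSemiPowAbelian p i G) {m : ℕ}
    (hcard : (powSet p i G).ncard = p ^ m) {f : G →* Multiplicative (Fin m → ZMod p)}
    (hf : Function.Surjective f) (hker : ∀ x, x ^ p ^ i = 1 → f x = 1) {x y : G}
    (hxy : f x = f y) : x ^ p ^ i = y ^ p ^ i := by
  let g := QuotientGroup.lift h.powKer f hker
  have hg : Function.Surjective g := fun u => by
    obtain ⟨x, rfl⟩ := hf u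
    exact ⟨x, rfl⟩
  have hc : Nat.card (G ⧸ h.powKer) = Nat.card (Multiplicative (Fin m → ZMod p)) := by
    rw [h.card_quotient_powKer, hcard, Nat.card_congr Multiplicative.toAdd]
    simp
  have hinj := ((Nat.bijective_iff_surjective_and_card g).2 ⟨hg, hc⟩).injective
  exact h.mk_eq_mk_iff.1 (hinj hxy)

end IsSemiPowAbelian

/-! ### Disjointness tested on elements of order p -/

theorem mem_sigmaSet {G : Type*} [Group G] {T : List G} {y : G} :
    y ∈ sigmaSet T ↔ ∃ g : G, ∃ x ∈ T, ∃ n : ℤ, y = g⁻¹ * x ^ n * g := by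
  simp [sigmaSet, Subgroup.mem_zpowers_iff]

theorem one_mem_sigmaSet {G : Type*} [Group G] {T : List G} (hT : T ≠ []) :
    (1 : G) ∈ sigmaSet T := by
  obtain ⟨x, hx⟩ := List.exists_mem_of_ne_nil T hT
  exact mem_sigmaSet.2 ⟨1, x, hx, 0, by simp⟩

theorem IsRamificationStructure.symm {G : Type*} [Group G] {T₁ T₂ : List G}
    (h : IsRamificationStructure T₁ T₂) : IsRamificationStructure T₂ T₁ :=
  ⟨h.2, h.1, by rw [Set.inter_comm, h.3]⟩

theorem ramificationSizes_symm {G : Type*} [Group G] {r₁ r₂ : ℕ} :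
    (r₁, r₂) ∈ ramificationSizes G ↔ (r₂, r₁) ∈ ramificationSizes G :=
  ⟨fun ⟨T₁, T₂, h, h₁, h₂⟩ => ⟨T₂, T₁, h.symm, h₂, h₁⟩,
    fun ⟨T₁, T₂, h, h₁, h₂⟩ => ⟨T₂, T₁, h.symm, h₂, h₁⟩⟩

theorem conj_zpow' {G : Type*} [Group G] (g x : G) (n : ℤ) :
    (g⁻¹ * x * g) ^ n = g⁻¹ * x ^ n * g := by
  simpa using conj_zpow (i := n) (a := g⁻¹) (b := x)

theorem conj_pow' {G : Type*} [Group G] (g x : G) (n : ℕ) :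
    (g⁻¹ * x * g) ^ n = g⁻¹ * x ^ n * g := by
  simpa using conj_pow (i := n) (a := g⁻¹) (b := x)

theorem orderOf_conj' {G : Type*} [Group G] (g x : G) : orderOf (g⁻¹ * x * g) = orderOf x := by
  simpa using (MulAut.conj g⁻¹).orderOf_eq x

/-- The only element of order `2` in `⟨w⟩`. -/
theorem zpow_eq_of_orderOf_eq_two {G : Type*} [Group G] {w : G} {n : ℤ}
    (hn : orderOf (w ^ n) = 2) : w ^ n = w ^ (orderOf w / 2) := by
  obtain ⟨M, hM⟩ : 2 ∣ orderOf w :=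
    hn ▸ orderOf_dvd_of_mem_zpowers (Subgroup.zpow_mem_zpowers w n)
  have h1 : w ^ (2 * n) = 1 := by
    rw [mul_comm, zpow_mul, zpow_ofNat, ← hn, pow_orderOf_eq_one]
  rw [← orderOf_dvd_iff_zpow_eq_one, hM, Nat.cast_mul] at h1
  obtain ⟨c, rfl⟩ := Int.dvd_of_mul_dvd_mul_left two_ne_zero h1
  have hMM : (w ^ M) ^ 2 = 1 := by rw [← pow_mul, mul_comm, ← hM, pow_orderOf_eq_one]
  have hpow : ∀ d : ℤ, w ^ ((M : ℤ) * (2 * d)) = 1 := fun d => by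
    rw [zpow_mul, zpow_natCast, zpow_mul, zpow_ofNat, hMM, one_zpow]
  obtain ⟨d, rfl⟩ : Odd c := by
    refine Int.not_even_iff_odd.1 fun hc => ?_
    obtain ⟨d, rfl⟩ := hc.two_dvd
    rw [hpow, orderOf_one] at hn
    omega
  rw [hM, Nat.mul_div_cancel_left _ two_pos, mul_add, zpow_add, hpow, one_mul, mul_one,
    zpow_natCast]

/-- In a `p`-group, disjointness can be checked on elements of order `p`. -/
theorem sigmaSet_inter_eq_one {p : ℕ} [Fact p.Prime] {G : Type*} [Group G] [Finite G]
    (hG : IsPGroup p G)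
    {T₁ T₂ : List G} (h₁ : T₁ ≠ []) (h₂ : T₂ ≠ [])
    (h : ∀ x ∈ T₁, ∀ y ∈ T₂, ∀ (g k : G) (m n : ℤ), g⁻¹ * x ^ m * g = k⁻¹ * y ^ n * k →
      orderOf (x ^ m) ≠ p) : sigmaSet T₁ ∩ sigmaSet T₂ = {1} := by
  refine Set.Subset.antisymm ?_ (by simpa using ⟨one_mem_sigmaSet h₁, one_mem_sigmaSet h₂⟩)
  rintro a ⟨ha₁, ha₂⟩
  by_contra ha
  obtain ⟨g, x, hx, m, rfl⟩ := mem_sigmaSet.1 ha₁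
  obtain ⟨k, y, hy, n, hxy⟩ := mem_sigmaSet.1 ha₂
  obtain ⟨j, hj⟩ := (IsPGroup.iff_orderOf.1 hG) (x ^ m)
  have hj0 : j ≠ 0 := by
    rintro rfl
    rw [pow_zero, orderOf_eq_one_iff] at hj
    exact ha (by simp [hj])
  -- Raising the common element, of order p ^ j, to the power p ^ (j - 1) gives one of order p.
  refine h x hx y hy g k (m * (p ^ (j - 1) : ℕ)) (n * (p ^ (j - 1) : ℕ)) ?_ ?_
  · rw [zpow_mul, zpow_mul, zpow_natCast, zpow_natCast, ← conj_pow', hxy, conj_pow']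
  · rw [zpow_mul, zpow_natCast, orderOf_pow, hj,
      Nat.gcd_eq_right (pow_dvd_pow p (Nat.sub_le j 1)),
      Nat.pow_div (Nat.sub_le j 1) (Fact.out : p.Prime).pos,
      Nat.sub_sub_self (Nat.one_le_iff_ne_zero.2 hj0), pow_one]

/-- Elements of order `p` in `⟨x⟩`, for `x` of maximal order, are `p ^ (e - 1)`-th powers. -/
theorem exists_zpow_eq_zpow_pow {p e : ℕ} [hp : Fact p.Prime] {G : Type*} [Group G]
    (hexp : Monoid.exponent G = p ^ e) {x : G} (hx : x ^ p ^ (e - 1) ≠ 1) {m : ℤ}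
    (hm : orderOf (x ^ m) = p) : ∃ k : ℤ, x ^ m = (x ^ k) ^ p ^ (e - 1) ∧ ¬ (p : ℤ) ∣ k := by
  have hpe : x ^ p ^ e = 1 := hexp ▸ Monoid.pow_exponent_eq_one x
  have he : e ≠ 0 := by rintro rfl; exact hx hpe
  have he1 : e - 1 + 1 = e := by omega
  -- `hx` forces e > 0, so truncated subtraction is harmless, and `x` has the maximal order p ^ e.
  have hord : orderOf x = p ^ (e - 1 + 1) := orderOf_eq_prime_pow hx (by rw [he1, hpe])
  have h1 : x ^ (m * p) = 1 := by
    rw [zpow_mul, zpow_natCast, ← hm, pow_orderOf_eq_one]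
  rw [← orderOf_dvd_iff_zpow_eq_one, hord, pow_succ, Nat.cast_mul] at h1
  obtain ⟨k, rfl⟩ := Int.dvd_of_mul_dvd_mul_right (by exact_mod_cast hp.out.ne_zero) h1
  refine ⟨k, by rw [mul_comm, zpow_mul, zpow_natCast], ?_⟩
  rintro ⟨l, rfl⟩
  have : x ^ (((p ^ (e - 1) : ℕ) : ℤ) * (p * l)) = 1 := by
    rw [← mul_assoc, ← Nat.cast_mul, ← pow_succ, he1, zpow_mul, zpow_natCast, hpe, one_zpow]
  rw [this, orderOf_one] at hm
  exact hp.out.one_lt.ne hm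

namespace IsSemiPowAbelian

variable {p e : ℕ} {G U : Type*} [Group G] [CommGroup U] {f : G →* U}

/-- The value of `f` depends only on the power, so equal powers in `G` can be compared through their
roots in `U`. -/
theorem apply_eq_of_pow_eq {i : ℕ} (h : IsSemiPowAbelian p i G)
    (hker : ∀ x, x ^ p ^ i = 1 → f x = 1) {x y : G} (hxy : x ^ p ^ i = y ^ p ^ i) : f x = f y := by
  have := hker _ ((h x y).1 hxy)
  rwa [map_mul, map_inv, mul_inv_eq_one] at this

theorem apply_conj (g x : G) : f (g⁻¹ * x * g) = f x := by
  rw [map_mul, map_mul, map_inv, mul_right_comm, inv_mul_cancel, one_mul]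

/-- Cyclic subgroups of maximal order with independent images have no common conjugates of
elements of order `p`. -/
theorem orderOf_ne_of_independent [hp : Fact p.Prime] (h : IsSemiPowAbelian p (e - 1) G)
    (hexp : Monoid.exponent G = p ^ e) (hU : ∀ u : U, u ^ p = 1)
    (hker : ∀ x, x ^ p ^ (e - 1) = 1 → f x = 1) {x y : G} (hx : f x ≠ 1) (hy : f y ≠ 1)
    (hxy : ∀ k l : ℤ, f x ^ k = f y ^ l → f x ^ k = 1) (g k : G) (m n : ℤ)
    (heq : g⁻¹ * x ^ m * g = k⁻¹ * y ^ n * k) : orderOf (x ^ m) ≠ p := by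
  intro hm
  have hn : orderOf (y ^ n) = p := by
    rw [← orderOf_conj' k, ← heq, orderOf_conj', hm]
  obtain ⟨a, ha, hpa⟩ := exists_zpow_eq_zpow_pow hexp (fun h => hx (hker x h)) hm
  obtain ⟨b, hb, -⟩ := exists_zpow_eq_zpow_pow hexp (fun h => hy (hker y h)) hn
  rw [ha, hb, ← conj_pow', ← conj_pow'] at heq
  -- Both sides of `heq` are now q-th powers, so their roots agree under `f`; independence then
  -- gives p ∣ a, which `hpa` forbids.
  have := h.apply_eq_of_pow_eq hker heq
  rw [apply_conj, apply_conj, map_zpow, map_zpow] at this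
  have h1 := hxy a b this
  rw [← orderOf_dvd_iff_zpow_eq_one, orderOf_eq_prime (hU _) hx] at h1
  exact hpa h1

/-- The case of an element `w` whose only involution is not of the form `u ^ 2 ^ (e - 1)`, unless
`f u = v`. -/
theorem orderOf_ne_of_involution (hexp : Monoid.exponent G = 2 ^ e) (hU : ∀ u : U, u ^ 2 = 1)
    (hker : ∀ x, x ^ 2 ^ (e - 1) = 1 → f x = 1) {w y : G} (hy : f y ≠ 1) {v : U} (hyv : f y ≠ v)
    (hw : ∀ u, w ^ (orderOf w / 2) = u ^ 2 ^ (e - 1) → f u = v) (g k : G) (m n : ℤ)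
    (heq : g⁻¹ * y ^ m * g = k⁻¹ * w ^ n * k) : orderOf (y ^ m) ≠ 2 := by
  intro hm
  have hn : orderOf (w ^ n) = 2 := by
    rw [← orderOf_conj' k, ← heq, orderOf_conj', hm]
  have hwn := zpow_eq_of_orderOf_eq_two hn
  obtain ⟨a, ha, hpa⟩ := exists_zpow_eq_zpow_pow hexp (fun h => hy (hker y h)) hm
  have hfa : f (y ^ a) = f y := by
    obtain ⟨c, rfl⟩ := Int.not_even_iff_odd.1 fun h => hpa h.two_dvd
    rw [map_zpow, zpow_add_one, zpow_mul, zpow_ofNat, hU, one_zpow, one_mul]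
  -- A conjugate of `y ^ a` is a q-th root of the involution of ⟨w⟩, and `f` takes the value `f y`
  -- on it.
  refine hyv ?_
  rw [← hw (k * (g⁻¹ * y ^ a * g) * k⁻¹), map_mul, map_mul, map_inv, mul_inv_cancel_comm,
    apply_conj, hfa]
  rw [conj_pow, conj_pow', ← ha, heq, ← hwn]
  group

end IsSemiPowAbelian

/-! ### Lifting spherical systems from a quotient -/

/-- Spherical systems of a quotient of `G` lift to `G` if they are large enough. -/
theorem IsSphericalSystem.exists_lift {G U : Type*} [Group G] [Group U] [Finite G] {f : G →* U}
    (hf : Function.Surjective f) {L : List U} (hL : IsSphericalSystem L)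
    (hr : Group.rank G + 1 ≤ L.length) : ∃ T : List G, IsSphericalSystem T ∧ T.map f = L := by
  rcases L with _ | ⟨l, L⟩
  · simp at hr
  obtain ⟨x, hx⟩ := exists_closure_range_eq_top (Nat.le_of_succ_le_succ hr)
  obtain ⟨T, hT, hcl, hpr⟩ := exists_list_lift hf (ws := []) (by simp) hL.prod_eq_one
    hL.closure_eq_top (x := x) (by simpa using hx)
  refine ⟨T, ⟨?_, by simpa using hcl, by simpa using hpr⟩, hT⟩
  rintro x hx rfl
  exact hL.ne_one (f 1) (hT ▸ List.mem_map_of_mem hx) (map_one f)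

/-- Two spherical systems of a quotient of exponent `p` with pairwise independent members lift to a
ramification structure. -/
theorem IsSemiPowAbelian.mem_ramificationSizes_of_quotient {p e : ℕ} [hp : Fact p.Prime]
    {G U : Type*} [Group G] [Finite G] [CommGroup U] (hG : IsPGroup p G)
    (hexp : Monoid.exponent G = p ^ e) (h : IsSemiPowAbelian p (e - 1) G) {f : G →* U}
    (hU : ∀ u : U, u ^ p = 1) (hf : Function.Surjective f)
    (hker : ∀ x, x ^ p ^ (e - 1) = 1 → f x = 1) {L₁ L₂ : List U} (h₁ : IsSphericalSystem L₁)
    (h₂ : IsSphericalSystem L₂)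
    (hind : ∀ a ∈ L₁, ∀ b ∈ L₂, ∀ k l : ℤ, a ^ k = b ^ l → a ^ k = 1)
    (hr₁ : Group.rank G + 1 ≤ L₁.length) (hr₂ : Group.rank G + 1 ≤ L₂.length) :
    (L₁.length, L₂.length) ∈ ramificationSizes G := by
  obtain ⟨T₁, hT₁, rfl⟩ := h₁.exists_lift hf hr₁
  obtain ⟨T₂, hT₂, rfl⟩ := h₂.exists_lift hf hr₂
  refine ⟨T₁, T₂, ⟨hT₁, hT₂, ?_⟩, by simp, by simp⟩
  refine sigmaSet_inter_eq_one hG (by rintro rfl; simp at hr₁) (by rintro rfl; simp at hr₂) ?_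
  intro x hx y hy
  exact h.orderOf_ne_of_independent hexp hU hker (h₁.ne_one _ (List.mem_map_of_mem hx))
    (h₂.ne_one _ (List.mem_map_of_mem hy))
    (hind _ (List.mem_map_of_mem hx) _ (List.mem_map_of_mem hy))

theorem closure_eq_top_of_single {p m : ℕ} {S : Set (Multiplicative (Fin m → ZMod p))}
    (h : ∀ i, Multiplicative.ofAdd (Pi.single i 1 : Fin m → ZMod p) ∈ Subgroup.closure S) :
    Subgroup.closure S = ⊤ := by
  rw [eq_top_iff]
  rintro u -
  choose z hz using fun i => ZMod.intCast_surjective (u.toAdd i)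
  have hu : u = ∏ i, Multiplicative.ofAdd (Pi.single i 1 : Fin m → ZMod p) ^ z i := by
    apply Multiplicative.toAdd.injective
    rw [toAdd_prod]
    ext j
    simp [Finset.sum_apply, Pi.single_apply, hz]
  rw [hu]
  exact prod_mem fun i _ => zpow_mem (h i) _

/-! ### Odd primes -/

/-- The determinant of two plane vectors. -/
def planeDet {R : Type*} [CommRing R] (x y : Fin 2 → R) : R := x 0 * y 1 - x 1 * y 0

/-- These are the coefficients of vectors placed on one line; the entry 1 keeps the direction vector
itself in the list. Pairs 1, -1 adjust the length, and odd lengths start from 1, 1, -2, hence the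
need for 2 ≠ 0. -/
theorem exists_list_sum_eq_zero {R : Type*} [CommRing R] (h2 : (2 : R) ≠ 0) {n : ℕ} (hn : 2 ≤ n) :
    ∃ ks : List R, ks.length = n ∧ ks.sum = 0 ∧ (∀ k ∈ ks, k ≠ 0) ∧ 1 ∈ ks := by
  have h1 : (1 : R) ≠ 0 := fun h => h2 (by rw [← one_add_one_eq_two, h, add_zero])
  induction n using Nat.strong_induction_on with
  | _ n ih =>
  rcases (by omega : n = 2 ∨ n = 3 ∨ 2 ≤ n - 2) with rfl | rfl | hn2
  · exact ⟨[1, -1], by simp, by simp, by simp [h1], by simp⟩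
  · exact ⟨[1, 1, -2], by simp, by norm_num, by simp [h1, h2], by simp⟩
  · obtain ⟨ks, hl, hs, h0, -⟩ := ih (n - 2) (by omega) hn2
    refine ⟨1 :: -1 :: ks, by simp [hl]; omega, by simp [hs], ?_, by simp⟩
    simpa [h1] using h0

/-- Cramer's rule, together with the fact that scalar multiples over `ZMod p` are powers in the
multiplicative notation. -/
theorem planeDet_closure_eq_top {p : ℕ} [Fact p.Prime] {c d : Fin 2 → ZMod p}
    (hcd : planeDet c d ≠ 0) {S : Set (Multiplicative (Fin 2 → ZMod p))}
    (hc : Multiplicative.ofAdd c ∈ Subgroup.closure S)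
    (hd : Multiplicative.ofAdd d ∈ Subgroup.closure S) : Subgroup.closure S = ⊤ := by
  have hsmul : ∀ (v : Fin 2 → ZMod p), Multiplicative.ofAdd v ∈ Subgroup.closure S →
      ∀ s : ZMod p, Multiplicative.ofAdd (s • v) ∈ Subgroup.closure S := by
    intro v hv s
    have : s • v = s.val • v := by
      rw [← Nat.cast_smul_eq_nsmul (ZMod p), ZMod.natCast_zmod_val]
    rw [this, ofAdd_nsmul]
    exact pow_mem hv _
  rw [eq_top_iff]
  rintro u -
  have hu : u = Multiplicative.ofAdd ((planeDet u.toAdd d / planeDet c d) • c) *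
      Multiplicative.ofAdd ((planeDet c u.toAdd / planeDet c d) • d) := by
    rw [← ofAdd_add]
    apply Multiplicative.toAdd.injective
    ext i
    simp only [toAdd_ofAdd, Pi.add_apply, Pi.smul_apply, smul_eq_mul]
    rw [div_mul_eq_mul_div, div_mul_eq_mul_div, ← add_div, eq_div_iff hcd]
    fin_cases i <;> simp [planeDet] <;> ring
  rw [hu]
  exact mul_mem (hsmul c hc _) (hsmul d hd _)

theorem isSphericalSystem_map_ofAdd {V : Type*} [AddCommGroup V] {L : List V}
    (h0 : ∀ v ∈ L, v ≠ 0) (hs : L.sum = 0)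
    (hc : Subgroup.closure {x | x ∈ L.map Multiplicative.ofAdd} = ⊤) :
    IsSphericalSystem (L.map Multiplicative.ofAdd) := by
  refine ⟨List.forall_mem_map.2 fun v hv => ?_, hc, ?_⟩
  · rw [Ne, ofAdd_eq_one]
    exact h0 v hv
  · rw [← ofAdd_list_prod, hs, ofAdd_zero]

/-- Spherical systems of any size at least `4` on two lines, or of size `3` on three lines, of the
plane over `ZMod p`. -/
theorem exists_isSphericalSystem_plane {p : ℕ} [hp : Fact p.Prime] (hp2 : p ≠ 2)
    {c d : Fin 2 → ZMod p} (hcd : planeDet c d ≠ 0) {r : ℕ} (hr : 3 ≤ r) (hr4 : p = 3 → 4 ≤ r) :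
    ∃ L : List (Multiplicative (Fin 2 → ZMod p)), IsSphericalSystem L ∧ L.length = r ∧
      ∀ x ∈ L, ∃ k : ZMod p, k ≠ 0 ∧ (x.toAdd = k • c ∨ x.toAdd = k • d ∨
        p ≠ 3 ∧ x.toAdd = k • (c + d)) := by
  have h2 : (2 : ZMod p) ≠ 0 := by
    intro h
    rw [← Nat.cast_ofNat, ZMod.natCast_eq_zero_iff] at h
    exact hp2 ((Nat.prime_dvd_prime_iff_eq hp.out Nat.prime_two).1 h)
  have hc0 : c ≠ 0 := by rintro rfl; simp [planeDet] at hcd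
  have hd0 : d ≠ 0 := by rintro rfl; simp [planeDet] at hcd
  rcases hr.lt_or_eq with hr | rfl
  · obtain ⟨ks, hl, hs, h0, h1⟩ := exists_list_sum_eq_zero h2 (n := r - 2) (by omega)
    refine ⟨([c, -c] ++ ks.map (· • d)).map Multiplicative.ofAdd,
      isSphericalSystem_map_ofAdd ?_ ?_ ?_, ?_, List.forall_mem_map.2 ?_⟩
    · simpa [hc0, hd0] using h0
    · simp [← List.sum_smul, hs]
    · refine planeDet_closure_eq_top hcd (Subgroup.subset_closure (by simp))
        (Subgroup.subset_closure ?_)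
      simpa using Or.inr (Or.inr ⟨1, h1, one_smul _ _⟩)
    · simp [hl]; omega
    · simp only [List.forall_mem_append, List.forall_mem_cons, List.forall_mem_map, toAdd_ofAdd]
      exact ⟨⟨⟨1, one_ne_zero, Or.inl (by simp)⟩, ⟨-1, by simp, Or.inl (by simp)⟩, by simp⟩,
        fun k hk => ⟨k, h0 k hk, Or.inr (Or.inl rfl)⟩⟩
  · have hp3 : p ≠ 3 := fun h => by have := hr4 h; omega
    refine ⟨[c, d, -(c + d)].map Multiplicative.ofAdd,
      isSphericalSystem_map_ofAdd ?_ ?_ ?_, by simp, List.forall_mem_map.2 ?_⟩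
    · have hcd0 : c + d ≠ 0 := by
        intro h
        obtain rfl : c = -d := by rwa [add_eq_zero_iff_eq_neg] at h
        exact hcd (by simp [planeDet]; ring)
      simp only [List.forall_mem_cons]
      exact ⟨hc0, hd0, neg_ne_zero.2 hcd0, by simp⟩
    · simp
    · exact planeDet_closure_eq_top hcd (Subgroup.subset_closure (by simp))
        (Subgroup.subset_closure (by simp))
    · simp only [List.forall_mem_cons, toAdd_ofAdd]
      exact ⟨⟨1, one_ne_zero, Or.inl (by simp)⟩, ⟨1, one_ne_zero, Or.inr (Or.inl (by simp))⟩,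
        ⟨-1, by simp, Or.inr (Or.inr ⟨hp3, by simp [add_comm]⟩)⟩, by simp⟩

/-- Taking the determinant with `b` kills the right-hand side, so k times a nonzero determinant is 0
in `ZMod p`. -/
theorem zpow_eq_one_of_planeDet_ne_zero {p : ℕ} [Fact p.Prime]
    {a b : Multiplicative (Fin 2 → ZMod p)} (hab : planeDet a.toAdd b.toAdd ≠ 0) {k l : ℤ}
    (h : a ^ k = b ^ l) : a ^ k = 1 := by
  have h' : ∀ i, (k : ZMod p) * a.toAdd i = l * b.toAdd i := fun i => by
    simpa using congrFun (congrArg Multiplicative.toAdd h) i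
  have hk : (k : ZMod p) * planeDet a.toAdd b.toAdd = 0 := by
    unfold planeDet
    linear_combination b.toAdd 1 * h' 0 - b.toAdd 0 * h' 1
  have hk0 := (mul_eq_zero.1 hk).resolve_right hab
  apply Multiplicative.toAdd.injective
  ext i
  simp [hk0]

/-- Existence for odd primes. -/
theorem IsSemiPowAbelian.mem_ramificationSizes_of_odd {p e : ℕ} [hp : Fact p.Prime] (hp2 : p ≠ 2)
    {G : Type*} [Group G] [Finite G]
    (hG : IsPGroup p G)
    (hexp : Monoid.exponent G = p ^ e) (h : IsSemiPowAbelian p (e - 1) G)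
    (hcard : p ^ 2 ≤ (powSet p (e - 1) G).ncard) {r₁ r₂ : ℕ} (hr₁ : Group.rank G + 1 ≤ r₁)
    (hr₂ : Group.rank G + 1 ≤ r₂) (h3₁ : 3 ≤ r₁) (h3₂ : 3 ≤ r₂) (h4 : p = 3 → 4 ≤ r₁ ∧ 4 ≤ r₂) :
    (r₁, r₂) ∈ ramificationSizes G := by
  obtain ⟨f, hf, hker⟩ := h.exists_surjective hexp (Or.inl rfl) hcard
  have h2 : (2 : ZMod p) ≠ 0 := by
    intro h
    rw [← Nat.cast_ofNat, ZMod.natCast_eq_zero_iff] at h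
    exact hp2 ((Nat.prime_dvd_prime_iff_eq hp.out Nat.prime_two).1 h)
  -- For p ≥ 5 the six vectors (1,0), (0,1), (1,1) and (1,2), (1,-1), (2,1) span distinct lines. For
  -- p = 3 the plane has only four lines, two for each system, and (1,2) = (1,-1), so another pair
  -- is chosen.
  obtain ⟨c, d, hcd, hdet⟩ : ∃ c d : Fin 2 → ZMod p, planeDet c d ≠ 0 ∧
      ∀ x y : Fin 2 → ZMod p, (x = ![1, 0] ∨ x = ![0, 1] ∨ p ≠ 3 ∧ x = ![1, 1]) →
        (y = c ∨ y = d ∨ p ≠ 3 ∧ y = c + d) → planeDet x y ≠ 0 := by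
    by_cases hp3 : p = 3
    · refine ⟨![1, 1], ![1, -1], ?_, ?_⟩
      · have : planeDet ![1, 1] ![1, -1] = -(2 : ZMod p) := by simp [planeDet]; norm_num
        rw [this]
        exact neg_ne_zero.2 h2
      · rintro x y (rfl | rfl | hx) (rfl | rfl | hy)
        all_goals first | exact absurd hp3 hx.1 | exact absurd hp3 hy.1 | simp [planeDet]
    · have h3 : (3 : ZMod p) ≠ 0 := by
        intro h
        rw [← Nat.cast_ofNat, ZMod.natCast_eq_zero_iff] at h
        exact hp3 ((Nat.prime_dvd_prime_iff_eq hp.out Nat.prime_three).1 h)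
      refine ⟨![1, 2], ![1, -1], ?_, ?_⟩
      · have : planeDet ![1, 2] ![1, -1] = -(3 : ZMod p) := by simp [planeDet]; norm_num
        rw [this]
        exact neg_ne_zero.2 h3
      · have hcd : (![1, 2] + ![1, -1] : Fin 2 → ZMod p) = ![2, 1] := by
          ext i
          fin_cases i <;> norm_num
        rw [hcd]
        rintro x y (rfl | rfl | ⟨-, rfl⟩) (rfl | rfl | ⟨-, rfl⟩) <;>
          norm_num [planeDet, h2]
  have hab : planeDet (![1, 0] : Fin 2 → ZMod p) ![0, 1] ≠ 0 := by simp [planeDet]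
  obtain ⟨L₁, hL₁, rfl, hl₁⟩ :=
    exists_isSphericalSystem_plane hp2 hab h3₁ (fun h => (h4 h).1)
  obtain ⟨L₂, hL₂, rfl, hl₂⟩ := exists_isSphericalSystem_plane hp2 hcd h3₂ (fun h => (h4 h).2)
  refine h.mem_ramificationSizes_of_quotient hG hexp ?_ hf hker hL₁ hL₂ ?_ hr₁ hr₂
  · intro u
    apply Multiplicative.toAdd.injective
    ext i
    simp
  · intro x hx y hy k l
    refine zpow_eq_one_of_planeDet_ne_zero ?_
    obtain ⟨s, hs, hxs⟩ := hl₁ x hx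
    obtain ⟨t, ht, hyt⟩ := hl₂ y hy
    have hab' : (![1, 0] + ![0, 1] : Fin 2 → ZMod p) = ![1, 1] := by simp
    rw [hab'] at hxs
    obtain ⟨v, hv, hxv⟩ : ∃ v : Fin 2 → ZMod p,
        (v = ![1, 0] ∨ v = ![0, 1] ∨ p ≠ 3 ∧ v = ![1, 1]) ∧ x.toAdd = s • v := by
      rcases hxs with h | h | ⟨h3, h⟩
      exacts [⟨_, Or.inl rfl, h⟩, ⟨_, Or.inr (Or.inl rfl), h⟩, ⟨_, Or.inr (Or.inr ⟨h3, rfl⟩), h⟩]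
    obtain ⟨w, hw, hyw⟩ : ∃ w : Fin 2 → ZMod p,
        (w = c ∨ w = d ∨ p ≠ 3 ∧ w = c + d) ∧ y.toAdd = t • w := by
      rcases hyt with h | h | ⟨h3, h⟩
      exacts [⟨_, Or.inl rfl, h⟩, ⟨_, Or.inr (Or.inl rfl), h⟩, ⟨_, Or.inr (Or.inr ⟨h3, rfl⟩), h⟩]
    have : planeDet x.toAdd y.toAdd = s * t * planeDet v w := by
      rw [hxv, hyw]
      simp [planeDet]
      ring
    rw [this]
    exact mul_ne_zero (mul_ne_zero hs ht) (hdet v w hv hw)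

/-! ### The prime `2` -/

/-- In exponent 2 the only powers of u are 1 and u, so independence is just distinctness. -/
theorem zpow_eq_one_of_ne {U : Type*} [Group U] (hU : ∀ u : U, u ^ 2 = 1) {a b : U} (hab : a ≠ b)
    {k l : ℤ} (h : a ^ k = b ^ l) : a ^ k = 1 := by
  have hpow : ∀ (u : U) (n : ℤ), u ^ n = 1 ∨ u ^ n = u := by
    intro u n
    rcases Int.even_or_odd' n with ⟨c, rfl | rfl⟩
    · left
      rw [zpow_mul, zpow_ofNat, hU, one_zpow]
    · right
      rw [zpow_add_one, zpow_mul, zpow_ofNat, hU, one_zpow, one_mul]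
  rcases hpow a k with ha | ha
  · exact ha
  · rcases hpow b l with hb | hb
    · rw [h, hb]
    · exact absurd (ha.symm.trans (h.trans hb)) hab

theorem IsSphericalSystem.append_replicate {U : Type*} [Group U] (hU : ∀ u : U, u ^ 2 = 1)
    {L : List U} (hL : IsSphericalSystem L) {s : U} (hs : s ∈ L) (k : ℕ) :
    IsSphericalSystem (L ++ List.replicate (2 * k) s) := by
  have hmem : ∀ x, x ∈ L ++ List.replicate (2 * k) s ↔ x ∈ L := by
    intro x
    rw [List.mem_append, List.mem_replicate]
    constructor
    · rintro (h | ⟨-, rfl⟩) <;> assumption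
    · exact Or.inl
  refine ⟨fun x hx => hL.ne_one x ((hmem x).1 hx), ?_, ?_⟩
  · simp_rw [hmem]
    exact hL.closure_eq_top
  · rw [List.prod_append, hL.prod_eq_one, List.prod_replicate, pow_mul, hU, one_pow, one_mul]

/-- Prolonging a spherical system by pairs. -/
theorem IsSphericalSystem.exists_length_eq {U : Type*} [Group U] (hU : ∀ u : U, u ^ 2 = 1)
    {L : List U} (hL : IsSphericalSystem L) (hL0 : L ≠ []) {r : ℕ} (hr : L.length ≤ r)
    (hpar : r % 2 = L.length % 2) :
    ∃ L' : List U, IsSphericalSystem L' ∧ L'.length = r ∧ ∀ x ∈ L', x ∈ L := by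
  obtain ⟨s, hs⟩ := List.exists_mem_of_ne_nil L hL0
  refine ⟨_, hL.append_replicate hU hs ((r - L.length) / 2), ?_, ?_⟩
  · rw [List.length_append, List.length_replicate]
    omega
  · intro x hx
    rw [List.mem_append, List.mem_replicate] at hx
    rcases hx with h | ⟨-, rfl⟩ <;> assumption

/-- Appending pairs of equal members preserves parity, so one start of each parity is enough. -/
theorem exists_isSphericalSystem_of_five_six {U : Type*} [Group U] (hU : ∀ u : U, u ^ 2 = 1)
    {L₅ L₆ : List U} (h₅ : IsSphericalSystem L₅) (h₆ : IsSphericalSystem L₆)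
    (hl₅ : L₅.length = 5) (hl₆ : L₆.length = 6) {r : ℕ} (hr : 5 ≤ r) :
    ∃ L : List U, IsSphericalSystem L ∧ L.length = r ∧ ∀ x ∈ L, x ∈ L₅ ++ L₆ := by
  rcases Nat.mod_two_eq_zero_or_one r with hmod | hmod
  · obtain ⟨L, hL, hl, hx⟩ := h₆.exists_length_eq hU (by rintro rfl; simp at hl₆) (r := r)
      (by omega) (by omega)
    exact ⟨L, hL, hl, fun x h => List.mem_append_right _ (hx x h)⟩
  · obtain ⟨L, hL, hl, hx⟩ := h₅.exists_length_eq hU (by rintro rfl; simp at hl₅) (r := r)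
      (by omega) (by omega)
    exact ⟨L, hL, hl, fun x h => List.mem_append_left _ (hx x h)⟩

/-- A list of vectors is a spherical system if its sum is zero and the unit vectors are sums of
members of it. -/
theorem isSphericalSystem_of_single {p m : ℕ} {L : List (Fin m → ZMod p)}
    (M : Fin m → List (Fin m → ZMod p)) (h0 : ∀ v ∈ L, v ≠ 0) (hs : L.sum = 0)
    (hM : ∀ i, ∀ v ∈ M i, v ∈ L) (hMs : ∀ i, (M i).sum = Pi.single i 1) :
    IsSphericalSystem (L.map Multiplicative.ofAdd) := by
  refine isSphericalSystem_map_ofAdd h0 hs (closure_eq_top_of_single fun i => ?_)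
  rw [← hMs, ofAdd_list_prod]
  refine Subgroup.list_prod_mem _ (List.forall_mem_map.2 fun v hv => ?_)
  exact Subgroup.subset_closure (List.mem_map_of_mem (hM i v hv))

theorem multiplicative_zmod_two_sq {m : ℕ} (u : Multiplicative (Fin m → ZMod 2)) : u ^ 2 = 1 := by
  apply Multiplicative.toAdd.injective
  ext i
  simp only [toAdd_pow, Pi.smul_apply, nsmul_eq_mul, toAdd_one, Pi.zero_apply]
  rw [show ((2 : ℕ) : ZMod 2) = 0 from rfl, zero_mul]

/-- `C_2 ^ 4` has room for both parities on both sides: the first systems use the unit vectors, 1111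
and 1110; the second use the six vectors 1100, 0011, 1010, 1001, 1101, 1011. -/
theorem exists_isSphericalSystem_four {r₁ r₂ : ℕ} (h₁ : 5 ≤ r₁) (h₂ : 5 ≤ r₂) :
    ∃ L₁ L₂ : List (Multiplicative (Fin 4 → ZMod 2)), IsSphericalSystem L₁ ∧
      IsSphericalSystem L₂ ∧ L₁.length = r₁ ∧ L₂.length = r₂ ∧ ∀ a ∈ L₁, ∀ b ∈ L₂, a ≠ b := by
  obtain ⟨L₁, hL₁, hl₁, hx₁⟩ := exists_isSphericalSystem_of_five_six multiplicative_zmod_two_sq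
    (isSphericalSystem_of_single (p := 2) (m := 4)
      (L := [![1,0,0,0], ![0,1,0,0], ![0,0,1,0], ![0,0,0,1], ![1,1,1,1]])
      ![[![1,0,0,0]], [![0,1,0,0]], [![0,0,1,0]], [![0,0,0,1]]]
      (by decide) (by decide) (by decide) (by decide))
    (isSphericalSystem_of_single (p := 2) (m := 4)
      (L := [![1,0,0,0], ![0,1,0,0], ![0,0,1,0], ![1,1,1,0], ![0,0,0,1], ![0,0,0,1]])
      ![[![1,0,0,0]], [![0,1,0,0]], [![0,0,1,0]], [![0,0,0,1]]]
      (by decide) (by decide) (by decide) (by decide)) rfl rfl h₁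
  obtain ⟨L₂, hL₂, hl₂, hx₂⟩ := exists_isSphericalSystem_of_five_six multiplicative_zmod_two_sq
    (isSphericalSystem_of_single (p := 2) (m := 4)
      (L := [![1,1,0,1], ![1,0,1,1], ![1,1,0,0], ![0,0,1,1], ![1,0,0,1]])
      ![[![1,0,1,1], ![0,0,1,1]], [![1,0,1,1], ![0,0,1,1], ![1,1,0,0]],
        [![0,0,1,1], ![1,1,0,1], ![1,1,0,0]], [![1,1,0,1], ![1,1,0,0]]]
      (by decide) (by decide) (by decide) (by decide))
    (isSphericalSystem_of_single (p := 2) (m := 4)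
      (L := [![1,1,0,0], ![1,0,1,0], ![1,1,0,1], ![1,0,1,1], ![1,0,0,1], ![1,0,0,1]])
      ![[![1,0,0,1], ![1,1,0,1], ![1,1,0,0]], [![1,1,0,1], ![1,0,0,1]],
        [![1,0,1,1], ![1,0,0,1]], [![1,1,0,1], ![1,1,0,0]]]
      (by decide) (by decide) (by decide) (by decide)) rfl rfl h₂
  refine ⟨L₁, L₂, hL₁, hL₂, hl₁, hl₂, fun a ha b hb => ?_⟩
  refine (?_ : ∀ a ∈ _, ∀ b ∈ _, a ≠ b) a (hx₁ a ha) b (hx₂ b hb)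
  decide

/-- In `C_2 ^ 3`, one of the two systems may consist of unit vectors. -/
theorem exists_isSphericalSystem_three {r₁ r₂ : ℕ} (h₁ : 5 ≤ r₁) (h₂ : 6 ≤ r₂) (h₂' : Even r₂) :
    ∃ L₁ L₂ : List (Multiplicative (Fin 3 → ZMod 2)), IsSphericalSystem L₁ ∧
      IsSphericalSystem L₂ ∧ L₁.length = r₁ ∧ L₂.length = r₂ ∧ (∀ a ∈ L₁, ∀ b ∈ L₂, a ≠ b) ∧
      ∀ a ∈ L₁, a ≠ Multiplicative.ofAdd ![1,0,0] := by
  obtain ⟨L₁, hL₁, hl₁, hx₁⟩ := exists_isSphericalSystem_of_five_six multiplicative_zmod_two_sq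
    (isSphericalSystem_of_single (p := 2) (m := 3)
      (L := [![1,1,0], ![1,0,1], ![0,1,1], ![1,1,1], ![1,1,1]])
      ![[![1,1,1], ![0,1,1]], [![1,1,1], ![1,0,1]], [![1,1,1], ![1,1,0]]]
      (by decide) (by decide) (by decide) (by decide))
    (isSphericalSystem_of_single (p := 2) (m := 3)
      (L := [![1,1,0], ![1,1,0], ![1,0,1], ![1,0,1], ![1,1,1], ![1,1,1]])
      ![[![1,1,1], ![1,1,0], ![1,0,1]], [![1,1,1], ![1,0,1]], [![1,1,1], ![1,1,0]]]
      (by decide) (by decide) (by decide) (by decide)) rfl rfl h₁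
  -- The first systems use the four non-trivial vectors outside the standard basis. This leaves only
  -- the basis, whose members must each occur evenly often.
  obtain ⟨L₂, hL₂, hl₂, hx₂⟩ := IsSphericalSystem.exists_length_eq multiplicative_zmod_two_sq
    (isSphericalSystem_of_single (p := 2) (m := 3)
      (L := [![1,0,0], ![1,0,0], ![0,1,0], ![0,1,0], ![0,0,1], ![0,0,1]])
      ![[![1,0,0]], [![0,1,0]], [![0,0,1]]]
      (by decide) (by decide) (by decide) (by decide)) (by simp) (r := r₂) h₂
      (by simpa using Nat.even_iff.1 h₂')
  refine ⟨L₁, L₂, hL₁, hL₂, hl₁, hl₂, fun a ha b hb => ?_, fun a ha => ?_⟩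
  · refine (?_ : ∀ a ∈ _, ∀ b ∈ _, a ≠ b) a (hx₁ a ha) b (hx₂ b hb)
    decide
  · refine (?_ : ∀ a ∈ _, a ≠ _) a (hx₁ a ha)
    decide

namespace IsSemiPowAbelian

variable {e : ℕ} {G : Type*} [Group G] [Finite G]

theorem mem_ramificationSizes_of_sixteen_le (hG : IsPGroup 2 G)
    (hexp : Monoid.exponent G = 2 ^ e) (h : IsSemiPowAbelian 2 (e - 1) G)
    (hcard : 2 ^ 4 ≤ (powSet 2 (e - 1) G).ncard) {r₁ r₂ : ℕ} (hr₁ : Group.rank G + 1 ≤ r₁)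
    (hr₂ : Group.rank G + 1 ≤ r₂) (h5₁ : 5 ≤ r₁) (h5₂ : 5 ≤ r₂) :
    (r₁, r₂) ∈ ramificationSizes G := by
  obtain ⟨f, hf, hker⟩ := h.exists_surjective hexp (Or.inr rfl) hcard
  obtain ⟨L₁, L₂, hL₁, hL₂, rfl, rfl, hne⟩ := exists_isSphericalSystem_four h5₁ h5₂
  exact h.mem_ramificationSizes_of_quotient hG hexp multiplicative_zmod_two_sq hf hker hL₁ hL₂
    (fun a ha b hb _ _ => zpow_eq_one_of_ne multiplicative_zmod_two_sq (hne a ha b hb)) hr₁ hr₂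

theorem mem_ramificationSizes_of_even (hG : IsPGroup 2 G)
    (hexp : Monoid.exponent G = 2 ^ e) (h : IsSemiPowAbelian 2 (e - 1) G)
    (hcard : 2 ^ 3 ≤ (powSet 2 (e - 1) G).ncard) {r₁ r₂ : ℕ} (hr₁ : Group.rank G + 1 ≤ r₁)
    (hr₂ : Group.rank G + 1 ≤ r₂) (h5₁ : 5 ≤ r₁) (h5₂ : 5 ≤ r₂) (heven : Even r₂) :
    (r₁, r₂) ∈ ramificationSizes G := by
  obtain ⟨f, hf, hker⟩ := h.exists_surjective hexp (Or.inr rfl) hcard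
  obtain ⟨L₁, L₂, hL₁, hL₂, rfl, rfl, hne, -⟩ := exists_isSphericalSystem_three h5₁
    (r₂ := r₂) (by obtain ⟨c, rfl⟩ := heven; omega) heven
  exact h.mem_ramificationSizes_of_quotient hG hexp multiplicative_zmod_two_sq hf hker hL₁ hL₂
    (fun a ha b hb _ _ => zpow_eq_one_of_ne multiplicative_zmod_two_sq (hne a ha b hb)) hr₁ hr₂

/-- A non-trivial element of the kernel can be part of a generating set of prescribed size. -/
theorem exists_mem_ker_closure_eq_top (hexp : Monoid.exponent G = 2 ^ e) (he : 2 ≤ e)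
    {U : Type*} [Group U] (hU : ∀ u : U, u ^ 2 = 1) {f : G →* U} (hf : Function.Surjective f)
    {n : ℕ} {h : Fin n → U} (hh : Subgroup.closure (Set.range h) = ⊤)
    (hn : Group.rank G ≤ n + 1) :
    ∃ w : G, w ≠ 1 ∧ f w = 1 ∧
      ∃ x : Fin n → G, Subgroup.closure (Set.range x ∪ {w' | w' ∈ [w]}) = ⊤ := by
  obtain ⟨x, hx⟩ := exists_closure_range_eq_top hn
  -- Gaschütz applied to the padded tuple (1, h) puts the first lifted generator in the kernel.
  obtain ⟨y, hy, hy'⟩ := exists_lift_closure_eq_top hf (W := ∅) (by simp) (x := x)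
    (by simpa using hx) (h := (Fin.cons 1 h : Fin (n + 1) → U)) (by
      rw [Fin.range_cons, eq_top_iff, ← hh]
      exact Subgroup.closure_mono (Set.subset_insert _ _))
  rw [Set.union_empty] at hy'
  have hy0 : f (y 0) = 1 := congrFun hy 0
  by_cases h1 : y 0 = 1
  -- If that generator is trivial it is superfluous, and any non-trivial square, available since e ≥
  -- 2, can take its place.
  · obtain ⟨g, hg⟩ : ∃ g : G, g ^ 2 ≠ 1 := by
      by_contra! hall
      have := (Nat.pow_dvd_pow_iff_le_right (by norm_num : 1 < 2)).1
        ((hexp ▸ Monoid.exponent_dvd_of_forall_pow_eq_one hall : 2 ^ e ∣ 2).trans (by norm_num :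
          2 ∣ 2 ^ 1))
      omega
    refine ⟨g ^ 2, hg, by rw [map_pow, hU], Fin.tail y, ?_⟩
    rw [eq_top_iff, ← hy', Subgroup.closure_le]
    rintro _ ⟨i, rfl⟩
    refine Fin.cases ?_ (fun i => ?_) i
    · rw [h1]
      exact one_mem _
    · exact Subgroup.subset_closure (Or.inl ⟨i, rfl⟩)
  · refine ⟨y 0, h1, hy0, Fin.tail y, ?_⟩
    rw [eq_top_iff, ← hy', Subgroup.closure_le]
    rintro _ ⟨i, rfl⟩
    refine Subgroup.subset_closure (Fin.cases ?_ (fun i => ?_) i)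
    · exact Or.inr (by simp)
    · exact Or.inl ⟨i, rfl⟩

/-- The second list is a lift of a system of even size r₂ - 1 ≥ 6 supported on a basis, plus one
element w ≠ 1 of the kernel. If the involution of ⟨w⟩ is a q-th power u ^ q, then f u ≠ 1, and a
linear automorphism moves f u to (1,0,0), which the first list avoids. If it is not a q-th power,
nothing needs adjusting. -/
theorem mem_ramificationSizes_of_odd_odd (hG : IsPGroup 2 G)
    (hexp : Monoid.exponent G = 2 ^ e) (he : 2 ≤ e) (h : IsSemiPowAbelian 2 (e - 1) G)
    (hcard : (powSet 2 (e - 1) G).ncard = 2 ^ 3) {r₁ r₂ : ℕ} (hr₁ : Group.rank G + 1 ≤ r₁)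
    (hr₂ : Group.rank G + 1 ≤ r₂) (h5₁ : 5 ≤ r₁) (h7₂ : 7 ≤ r₂) (hodd : Odd r₂) :
    (r₁, r₂) ∈ ramificationSizes G := by
  obtain ⟨f, hf, hker⟩ := h.exists_surjective hexp (Or.inr rfl) hcard.ge
  obtain ⟨n, rfl⟩ : ∃ n, r₂ = n + 1 := ⟨r₂ - 1, by omega⟩
  obtain ⟨L₁, L₂, hL₁, hL₂, rfl, hlen, hne, hne1⟩ := exists_isSphericalSystem_three h5₁
    (r₂ := n) (by omega) (by rw [Nat.odd_add_one, Nat.not_odd_iff_even] at hodd; exact hodd)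
  rcases L₂ with _ | ⟨l, L₂⟩
  · simp at hlen; omega
  rw [← hlen, List.length_cons] at hr₂
  obtain ⟨w, hw1, hfw, x, hx⟩ := exists_mem_ker_closure_eq_top hexp he
    multiplicative_zmod_two_sq hf
    (closure_range_get_tail_eq_top hL₂.prod_eq_one hL₂.closure_eq_top) (by omega)
  have hinv : w ^ (orderOf w / 2) ≠ 1 := by
    have hpos := orderOf_pos w
    have hne1 : orderOf w ≠ 1 := fun h => hw1 (orderOf_eq_one_iff.1 h)
    refine pow_ne_one_of_lt_orderOf ?_ (by omega)
    omega
  obtain ⟨f', hf', hker', hfw', hv⟩ : ∃ f' : G →* Multiplicative (Fin 3 → ZMod 2),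
      Function.Surjective f' ∧ (∀ x, x ^ 2 ^ (e - 1) = 1 → f' x = 1) ∧ f' w = 1 ∧
      ∀ u, w ^ (orderOf w / 2) = u ^ 2 ^ (e - 1) → f' u = Multiplicative.ofAdd ![1,0,0] := by
    by_cases hu : ∃ u, w ^ (orderOf w / 2) = u ^ 2 ^ (e - 1)
    · obtain ⟨u, hu⟩ := hu
      have hfu : (f u).toAdd ≠ 0 := fun h0 => by
        have := h.pow_eq_pow_of_apply_eq hcard hf hker (x := u) (y := 1)
          (by rw [map_one]; exact h0)
        rw [one_pow] at this
        exact hinv (hu.trans this)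
      obtain ⟨φ, hφ⟩ := exists_linearEquiv_apply_eq (K := ZMod 2) hfu
        (show (![1,0,0] : Fin 3 → ZMod 2) ≠ 0 by decide)
      refine ⟨(AddMonoidHom.toMultiplicative φ.toLinearMap.toAddMonoidHom).comp f,
        ?_, fun x hx => ?_, ?_, fun u' hu' => ?_⟩
      · refine Function.Surjective.comp (g := AddMonoidHom.toMultiplicative _) ?_ hf
        exact φ.surjective
      · rw [MonoidHom.comp_apply, hker x hx, map_one]
      · rw [MonoidHom.comp_apply, hfw, map_one]
      · rw [MonoidHom.comp_apply, h.apply_eq_of_pow_eq hker (hu'.symm.trans hu)]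
        exact congrArg Multiplicative.ofAdd hφ
    · exact ⟨f, hf, hker, hfw, fun u h => absurd ⟨u, h⟩ hu⟩
  obtain ⟨T₁, hT₁, rfl⟩ := hL₁.exists_lift hf' hr₁
  obtain ⟨T₂, hT₂, hcl, hpr⟩ := exists_list_lift hf' (ws := [w]) (by simpa using hfw')
    hL₂.prod_eq_one hL₂.closure_eq_top hx
  have hmem₂ : ∀ y ∈ T₂, f' y ∈ l :: L₂ := fun y hy => hT₂ ▸ List.mem_map_of_mem hy
  refine ⟨T₁, w :: T₂, ⟨hT₁, ⟨?_, by simpa using hcl, by simpa using hpr⟩, ?_⟩, by simp, ?_⟩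
  · rw [List.forall_mem_cons]
    refine ⟨hw1, ?_⟩
    rintro y hy rfl
    exact hL₂.ne_one _ (hmem₂ 1 hy) (map_one f')
  · refine sigmaSet_inter_eq_one hG (by rintro rfl; simp at hr₁) (by simp) fun x hx => ?_
    have hx' := List.mem_map_of_mem (f := f') hx
    rw [List.forall_mem_cons]
    refine ⟨orderOf_ne_of_involution hexp multiplicative_zmod_two_sq hker' (hL₁.ne_one _ hx')
      (hne1 _ hx') hv, fun y hy => ?_⟩
    exact h.orderOf_ne_of_independent hexp multiplicative_zmod_two_sq hker' (hL₁.ne_one _ hx')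
      (hL₂.ne_one _ (hmem₂ y hy))
      fun k l => zpow_eq_one_of_ne multiplicative_zmod_two_sq (hne _ hx' _ (hmem₂ y hy))
  · have := congrArg List.length hT₂
    rw [List.length_map] at this
    simp [this, ← hlen]

end IsSemiPowAbelian

/-! ### Necessary conditions -/

theorem IsSphericalSystem.rank_add_one_le {G : Type*} [Group G] [Finite G] {T : List G}
    (hT : IsSphericalSystem T) (hT0 : T ≠ []) : Group.rank G + 1 ≤ T.length := by
  classical
  rcases T with _ | ⟨t, T⟩
  · exact absurd rfl hT0
  have h := closure_range_get_tail_eq_top hT.prod_eq_one hT.closure_eq_top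
  have h' : Subgroup.closure (T.toFinset : Set G) = ⊤ := by
    rw [← h]
    congr 1
    ext x
    simp
  exact Nat.succ_le_succ ((Group.rank_le h').trans (List.toFinset_card_le T))

/-- The empty list is a spherical system of the trivial group; it is excluded because its `sigmaSet`
is empty. -/
theorem IsRamificationStructure.ne_nil {G : Type*} [Group G] {T₁ T₂ : List G}
    (h : IsRamificationStructure T₁ T₂) : T₁ ≠ [] := by
  rintro rfl
  have : (1 : G) ∈ sigmaSet [] ∩ sigmaSet T₂ := by rw [h.disjoint]; rfl
  simp [sigmaSet] at this

/-- The form in which disjointness enters every necessity argument: such a power lies in both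
`sigmaSet`s. -/
theorem IsRamificationStructure.pow_eq_one_of_conj {G : Type*} [Group G] {T₁ T₂ : List G}
    (h : IsRamificationStructure T₁ T₂) {x y : G} (hx : x ∈ T₁) (hy : y ∈ T₂) {q : ℕ} {g : G}
    {n : ℤ} (hxy : x ^ q = (g⁻¹ * y ^ n * g) ^ q) : x ^ q = 1 := by
  have : x ^ q ∈ sigmaSet T₁ ∩ sigmaSet T₂ := by
    refine ⟨mem_sigmaSet.2 ⟨1, x, hx, q, by simp⟩, mem_sigmaSet.2 ⟨g, y, hy, n * q, ?_⟩⟩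
    rw [hxy, conj_pow', zpow_mul, zpow_natCast]
  rwa [h.disjoint] at this

theorem IsSphericalSystem.closure_map {G U : Type*} [Group G] [Group U] {f : G →* U}
    (hf : Function.Surjective f) {T : List G} (hT : IsSphericalSystem T) :
    Subgroup.closure {u | u ∈ T.map f} = ⊤ := by
  rw [← Subgroup.map_top_of_surjective f hf, ← hT.closure_eq_top, MonoidHom.map_closure]
  congr 1
  ext u
  simp

namespace IsSemiPowAbelian

variable {p e : ℕ} {G : Type*} [Group G]

theorem exists_pow_ne_one [hp : Fact p.Prime] (h : IsSemiPowAbelian p (e - 1) G)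
    (hexp : Monoid.exponent G = p ^ e) {T : List G} (hT : IsSphericalSystem T) (hT0 : T ≠ []) :
    ∃ t ∈ T, t ^ p ^ (e - 1) ≠ 1 := by
  by_contra! hall
  have htop : h.powKer = ⊤ := by
    rw [eq_top_iff, ← hT.closure_eq_top, Subgroup.closure_le]
    exact hall
  have hdvd : p ^ e ∣ p ^ (e - 1) := hexp ▸ Monoid.exponent_dvd_of_forall_pow_eq_one fun g =>
    h.mem_powKer.1 (htop ▸ Subgroup.mem_top g)
  have he := (Nat.pow_dvd_pow_iff_le_right hp.out.one_lt).1 hdvd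
  -- Truncated subtraction leaves the case e = 0, where `G` is trivial and has no non-trivial member
  -- for `T`.
  obtain rfl : e = 0 := by omega
  rw [pow_zero, Monoid.exp_eq_one_iff] at hexp
  obtain ⟨t, ht⟩ := List.exists_mem_of_ne_nil T hT0
  exact hT.ne_one t ht (Subsingleton.elim _ _)

theorem exists_ncard_eq_pow [Finite G] [hp : Fact p.Prime] {i : ℕ} (hG : IsPGroup p G)
    (h : IsSemiPowAbelian p i G) : ∃ k, (powSet p i G).ncard = p ^ k := by
  rw [← h.card_quotient_powKer]
  exact (IsPGroup.iff_card (p := p)).1 (hG.to_quotient h.powKer)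

/-- Each list has a member outside the kernel. In a quotient of order p the image of one would be a
power of the image of the other, giving a common non-trivial q-th power. -/
theorem sq_le_ncard [Finite G] [hp : Fact p.Prime] (hG : IsPGroup p G) (h : IsSemiPowAbelian p (e - 1) G)
    (hexp : Monoid.exponent G = p ^ e) {T₁ T₂ : List G} (hT : IsRamificationStructure T₁ T₂) :
    p ^ 2 ≤ (powSet p (e - 1) G).ncard := by
  obtain ⟨x, hx, hx1⟩ := h.exists_pow_ne_one hexp hT.spherical_left hT.ne_nil
  obtain ⟨y, hy, hy1⟩ := h.exists_pow_ne_one hexp hT.spherical_right hT.symm.ne_nil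
  obtain ⟨k, hk⟩ := h.exists_ncard_eq_pow hG
  rw [hk]
  refine Nat.pow_le_pow_right hp.out.pos ?_
  by_contra! hk2
  have hx2 : (x : G ⧸ h.powKer) ≠ 1 := fun h1 => hx1 ((QuotientGroup.eq_one_iff x).1 h1)
  have hy2 : (y : G ⧸ h.powKer) ≠ 1 := fun h1 => hy1 ((QuotientGroup.eq_one_iff y).1 h1)
  rw [← h.card_quotient_powKer] at hk
  interval_cases k
  · have := Finite.card_le_one_iff_subsingleton.1 (hk.trans (pow_zero p)).le
    exact hx2 (Subsingleton.elim _ _)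
  · obtain ⟨n, hn⟩ := mem_zpowers_of_prime_card (hk.trans (pow_one p)) hy2
      (g' := (x : G ⧸ h.powKer))
    refine hx1 (hT.pow_eq_one_of_conj hx hy (g := 1) (n := n) ?_)
    rw [inv_one, one_mul, mul_one]
    exact h.mk_eq_mk_iff.1 hn.symm

end IsSemiPowAbelian

/-! ### Generating sets of `C_2 ^ m` -/

theorem le_rank_multiplicative (p m : ℕ) [hp : Fact p.Prime] :
    m ≤ Group.rank (Multiplicative (Fin m → ZMod p)) := by
  have h := card_dvd_exponent_pow_rank' (Multiplicative (Fin m → ZMod p)) (n := p) fun u => by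
    apply Multiplicative.toAdd.injective
    ext i
    simp
  have hc : Nat.card (Multiplicative (Fin m → ZMod p)) = p ^ m := by
    rw [Nat.card_congr Multiplicative.toAdd]
    simp
  rw [hc] at h
  exact (Nat.pow_dvd_pow_iff_le_right hp.out.one_lt).1 h

theorem closure_toFinset_erase_one {U : Type*} [Group U] [DecidableEq U] {L : List U}
    (hL : Subgroup.closure {u | u ∈ L} = ⊤) :
    Subgroup.closure (L.toFinset.erase 1 : Set U) = ⊤ := by
  rw [eq_top_iff, ← hL, Subgroup.closure_le]
  intro u hu
  by_cases h1 : u = 1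
  · rw [h1]
    exact one_mem _
  · exact Subgroup.subset_closure (by simpa using ⟨hu, h1⟩)

/-- In a list with trivial product whose non-trivial members form a generating set of minimal size,
every non-trivial member occurs an even number of times. -/
theorem even_count_of_card_le_rank {U : Type*} [CommGroup U] [Finite U] [DecidableEq U]
    (hU : ∀ u : U, u ^ 2 = 1) {L : List U} (hprod : L.prod = 1)
    (hL : Subgroup.closure {u | u ∈ L} = ⊤) (hcard : (L.toFinset.erase 1).card ≤ Group.rank U)
    {s : U} (hs : s ∈ L.toFinset.erase 1) : Even (L.count s) := by
  by_contra hodd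
  obtain ⟨c, hc⟩ := Nat.not_even_iff_odd.1 hodd
  have hmem : ∀ u ∈ L.toFinset.erase s,
      u ∈ Subgroup.closure ((L.toFinset.erase 1).erase s : Set U) := by
    intro u hu
    by_cases h1 : u = 1
    · rw [h1]
      exact one_mem _
    · refine Subgroup.subset_closure ?_
      rw [Finset.mem_erase] at hu
      exact Finset.mem_erase.2 ⟨hu.1, Finset.mem_erase.2 ⟨h1, hu.2⟩⟩
  -- With an odd count, the trivial product expresses `s` through the other members, so `s` could be
  -- dropped from a minimal generating set.
  have hs' : s ∈ Subgroup.closure ((L.toFinset.erase 1).erase s : Set U) := by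
    rw [Finset.prod_list_count, ← Finset.mul_prod_erase _ _ (Finset.mem_of_mem_erase hs), hc,
      pow_succ, pow_mul, hU, one_pow, one_mul, mul_eq_one_iff_eq_inv] at hprod
    have hin := inv_mem (prod_mem fun u hu => pow_mem (hmem u hu) (L.count u))
    rwa [← hprod] at hin
  have htop : Subgroup.closure ((L.toFinset.erase 1).erase s : Set U) = ⊤ := by
    rw [eq_top_iff, ← hL, Subgroup.closure_le]
    intro u hu
    by_cases hus : u = s
    · rw [hus]
      exact hs'
    · exact hmem u (Finset.mem_erase.2 ⟨hus, List.mem_toFinset.2 hu⟩)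
  have h1 := Group.rank_le htop
  rw [Finset.card_erase_of_mem hs] at h1
  have h2 := Finset.card_pos.2 ⟨s, hs⟩
  omega

/-- At least rank many non-trivial members occur, each a positive even number of times; if 1 is
absent, the length is a sum of even counts. -/
theorem length_of_card_le_rank {U : Type*} [CommGroup U] [Finite U] [DecidableEq U]
    (hU : ∀ u : U, u ^ 2 = 1) {L : List U} (hprod : L.prod = 1)
    (hL : Subgroup.closure {u | u ∈ L} = ⊤) (hcard : (L.toFinset.erase 1).card ≤ Group.rank U) :
    2 * Group.rank U ≤ L.length ∧ (1 ∉ L → Even L.length) := by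
  have heven := fun s hs => even_count_of_card_le_rank hU hprod hL hcard (s := s) hs
  have hlen : ∑ u ∈ L.toFinset, L.count u = L.length := by
    simp
  constructor
  · calc 2 * Group.rank U ≤ 2 * (L.toFinset.erase 1).card :=
          Nat.mul_le_mul_left 2 (Group.rank_le (closure_toFinset_erase_one hL))
      _ = ∑ u ∈ L.toFinset.erase 1, 2 := by rw [Finset.sum_const, smul_eq_mul, mul_comm]
      _ ≤ ∑ u ∈ L.toFinset.erase 1, L.count u := Finset.sum_le_sum fun s hs => by
          have hpos : 0 < L.count s :=
            List.count_pos_iff.2 (List.mem_toFinset.1 (Finset.mem_of_mem_erase hs))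
          obtain ⟨c, hc⟩ := heven s hs
          omega
      _ ≤ L.length := hlen ▸ Finset.sum_le_sum_of_subset (Finset.erase_subset _ _)
  · intro h1
    rw [Finset.erase_eq_of_notMem (by simpa using h1)] at heven
    rw [← hlen]
    exact Finset.even_sum _ heven

/-! ### Necessary conditions for `p = 2` -/

/-- Here `f` and the q-th power determine each other, so a common non-trivial image is a common
non-trivial q-th power. -/
theorem IsRamificationStructure.disjoint_map {e m : ℕ} {G : Type*} [Group G]
    {T₁ T₂ : List G} (hT : IsRamificationStructure T₁ T₂)
    {f : G →* Multiplicative (Fin m → ZMod 2)} (hker : ∀ x, x ^ 2 ^ (e - 1) = 1 → f x = 1)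
    (hinj : ∀ x y, f x = f y → x ^ 2 ^ (e - 1) = y ^ 2 ^ (e - 1)) :
    Disjoint ((T₁.map f).toFinset.erase 1) ((T₂.map f).toFinset.erase 1) := by
  rw [Finset.disjoint_left]
  intro u hu₁ hu₂
  simp only [Finset.mem_erase, List.mem_toFinset, List.mem_map] at hu₁ hu₂
  obtain ⟨hu, x, hx, rfl⟩ := hu₁
  obtain ⟨-, y, hy, hxy⟩ := hu₂
  refine hu (hker x (hT.pow_eq_one_of_conj hx hy (g := 1) (n := 1) ?_))
  rw [inv_one, one_mul, mul_one, zpow_one]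
  exact hinj _ _ hxy.symm

theorem card_erase_one_add_card_le {m : ℕ} {S₁ S₂ : Finset (Multiplicative (Fin m → ZMod 2))}
    (hdisj : Disjoint (S₁.erase 1) (S₂.erase 1)) :
    (S₁.erase 1).card + (S₂.erase 1).card ≤ 2 ^ m - 1 := by
  rw [← Finset.card_union_of_disjoint hdisj]
  have hc : Fintype.card (Multiplicative (Fin m → ZMod 2)) = 2 ^ m := by
    rw [Fintype.card_multiplicative]
    simp
  rw [← hc, ← Finset.card_univ, ← Finset.card_erase_of_mem (Finset.mem_univ 1)]
  refine Finset.card_le_card fun u hu => ?_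
  rw [Finset.mem_union] at hu
  rcases hu with h | h <;> exact Finset.mem_erase.2 ⟨Finset.ne_of_mem_erase h, Finset.mem_univ _⟩

namespace IsSemiPowAbelian

variable {e : ℕ} {G : Type*} [Group G] [Finite G]

/-- Two disjoint sets of at least m non-trivial vectors must fit into 2 ^ m - 1, which fails for m =
2. -/
theorem eight_le_ncard (hG : IsPGroup 2 G) (h : IsSemiPowAbelian 2 (e - 1) G)
    (hexp : Monoid.exponent G = 2 ^ e) {T₁ T₂ : List G} (hT : IsRamificationStructure T₁ T₂) :
    2 ^ 3 ≤ (powSet 2 (e - 1) G).ncard := by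
  obtain ⟨m, hm⟩ := h.exists_ncard_eq_pow hG
  obtain ⟨f, hf, hker⟩ := h.exists_surjective hexp (Or.inr rfl) hm.ge
  have hdisj := hT.disjoint_map hker fun x y => h.pow_eq_pow_of_apply_eq hm hf hker
  have h1 := (le_rank_multiplicative 2 m).trans
    (Group.rank_le (closure_toFinset_erase_one (hT.spherical_left.closure_map hf)))
  have h2 := (le_rank_multiplicative 2 m).trans
    (Group.rank_le (closure_toFinset_erase_one (hT.spherical_right.closure_map hf)))
  have h3 := card_erase_one_add_card_le hdisj
  have h4 := h.sq_le_ncard hG hexp hT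
  rw [hm] at h4 ⊢
  have h5 := (Nat.pow_le_pow_iff_right one_lt_two).1 h4
  refine Nat.pow_le_pow_right two_pos ?_
  by_contra! hlt
  obtain rfl : m = 2 := by omega
  omega

theorem three_le_rank_zmod_two : 3 ≤ Group.rank (Multiplicative (Fin 3 → ZMod 2)) :=
  le_rank_multiplicative 2 3

/-- If there are `8` powers, the images of one of the two systems form a basis of `C_2 ^ 3`. -/
theorem length_cases (h : IsSemiPowAbelian 2 (e - 1) G)
    (hexp : Monoid.exponent G = 2 ^ e) (hcard : (powSet 2 (e - 1) G).ncard = 2 ^ 3)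
    {T₁ T₂ : List G} (hT : IsRamificationStructure T₁ T₂) :
    (6 ≤ T₁.length ∧ (e = 1 → Even T₁.length)) ∨ (6 ≤ T₂.length ∧ (e = 1 → Even T₂.length)) := by
  obtain ⟨f, hf, hker⟩ := h.exists_surjective hexp (Or.inr rfl) hcard.ge
  have hinj : ∀ x y, f x = f y → _ := fun x y => h.pow_eq_pow_of_apply_eq hcard hf hker
  have hsum := card_erase_one_add_card_le (hT.disjoint_map hker hinj)
  have hr := three_le_rank_zmod_two
  have key : ∀ T : List G, IsSphericalSystem T → ((T.map f).toFinset.erase 1).card ≤ 3 →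
      6 ≤ T.length ∧ (e = 1 → Even T.length) := by
    intro T hT hle
    obtain ⟨h1, h2⟩ := length_of_card_le_rank multiplicative_zmod_two_sq (L := T.map f)
      (by rw [← map_list_prod, hT.prod_eq_one, map_one]) (hT.closure_map hf) (hle.trans hr)
    rw [List.length_map] at h1 h2
    -- For e = 1 the power map is the identity, so no member of `T` maps to 1 and the parity
    -- statement applies.
    refine ⟨by omega, fun he => h2 fun hmem => ?_⟩
    obtain ⟨t, ht, ht1⟩ := List.mem_map.1 hmem
    have := hinj t 1 (by rw [ht1, map_one])
    subst he
    rw [one_pow, Nat.sub_self, pow_zero, pow_one] at this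
    exact hT.ne_one t ht this
  rcases le_or_gt ((T₁.map f).toFinset.erase 1).card 3 with h1 | h1
  · exact Or.inl (key T₁ hT.spherical_left h1)
  · exact Or.inr (key T₂ hT.spherical_right (by omega))

/-- If the size were at most 4, then m = 3 and the first list would map to four distinct non-trivial
vectors with product 1. The images of the second would fill the other three. All seven non-trivial
vectors multiply to 1, hence so would those three; but they form a basis. -/
theorem five_le_length (h : IsSemiPowAbelian 2 (e - 1) G) (hG : IsPGroup 2 G)
    (hexp : Monoid.exponent G = 2 ^ e) {T₁ T₂ : List G} (hT : IsRamificationStructure T₁ T₂) :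
    5 ≤ T₁.length := by
  have hlen := hT.spherical_left.rank_add_one_le hT.ne_nil
  have h8 := h.eight_le_ncard hG hexp hT
  obtain ⟨m, hm⟩ := h.exists_ncard_eq_pow hG
  obtain ⟨f, hf, hker⟩ := h.exists_surjective hexp (Or.inr rfl) hm.ge
  have hrank := (le_rank_multiplicative 2 m).trans (Group.rank_le_of_surjective f hf)
  rw [hm] at h8
  have hm3 := (Nat.pow_le_pow_iff_right one_lt_two).1 h8
  by_contra! hlt
  obtain rfl : m = 3 := by omega
  have hr := three_le_rank_zmod_two
  have hdisj := hT.disjoint_map hker fun x y => h.pow_eq_pow_of_apply_eq hm hf hker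
  have hsum := card_erase_one_add_card_le hdisj
  have hprod : (T₁.map f).prod = 1 := by
    rw [← map_list_prod, hT.spherical_left.prod_eq_one, map_one]
  have hcl₁ := hT.spherical_left.closure_map hf
  have hcl₂ := hT.spherical_right.closure_map hf
  have h2 := hr.trans (Group.rank_le (closure_toFinset_erase_one hcl₂))
  have h1 : 4 ≤ ((T₁.map f).toFinset.erase 1).card := by
    by_contra! h1
    have := (length_of_card_le_rank multiplicative_zmod_two_sq hprod hcl₁
      ((Nat.lt_succ_iff.1 h1).trans hr)).1
    rw [List.length_map] at this
    omega
  have hle := (Finset.card_erase_le (s := (T₁.map f).toFinset) (a := 1)).trans (List.toFinset_card_le (T₁.map f))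
  have hle' := Finset.card_erase_le (s := (T₁.map f).toFinset) (a := 1)
  have hle'' := List.toFinset_card_le (T₁.map f)
  rw [List.length_map] at hle hle''
  have herase : (T₁.map f).toFinset.erase 1 = (T₁.map f).toFinset := Finset.eq_of_subset_of_card_le (Finset.erase_subset _ _) (by omega)
  have hprod₁ : ∏ u ∈ (T₁.map f).toFinset.erase 1, u = 1 := by
    rw [herase]
    refine (List.prod_toFinset id ?_).trans (by rw [List.map_id, hprod])
    refine Multiset.coe_nodup.1 (Multiset.toFinset_card_eq_card_iff_nodup.1 ?_)
    change (T₁.map f).toFinset.card = (T₁.map f).length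
    rw [List.length_map]
    omega
  have hunion : (T₁.map f).toFinset.erase 1 ∪ (T₂.map f).toFinset.erase 1 = Finset.univ.erase 1 := by
    refine Finset.eq_of_subset_of_card_le (fun u hu => ?_) ?_
    · rw [Finset.mem_union] at hu
      rcases hu with h | h <;>
        exact Finset.mem_erase.2 ⟨Finset.ne_of_mem_erase h, Finset.mem_univ _⟩
    · rw [Finset.card_union_of_disjoint hdisj]
      have : (Finset.univ.erase (1 : Multiplicative (Fin 3 → ZMod 2))).card = 7 := by decide
      omega
  have hprod₂ : ((T₂.map f).toFinset.erase 1).toList.prod = 1 := by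
    have hall : ∏ u ∈ Finset.univ.erase (1 : Multiplicative (Fin 3 → ZMod 2)), u = 1 := by decide
    rw [← hunion, Finset.prod_union hdisj, hprod₁, one_mul] at hall
    rwa [Finset.prod_toList]
  have := (length_of_card_le_rank multiplicative_zmod_two_sq hprod₂ (by
    simp_rw [Finset.mem_toList]
    exact closure_toFinset_erase_one hcl₂) (by
    rw [Finset.toList_toFinset]
    exact (Finset.card_erase_le).trans (by omega))).1
  rw [Finset.length_toList] at this
  omega

end IsSemiPowAbelian

/-! ### Groups of exponent three -/

section ExponentThree

variable {H : Type*} [Group H]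

/-- In a group of exponent `3`, elements commute with their conjugates. -/
theorem commute_conj_of_pow_three (h3 : ∀ h : H, h ^ 3 = 1) (x y : H) :
    Commute x (y⁻¹ * x * y) := by
  have e1 : x * y⁻¹ * x = y * x⁻¹ * y := by
    have := h3 (x * y⁻¹)
    have h : x * y⁻¹ * x * (y * x⁻¹ * y)⁻¹ = (x * y⁻¹) ^ 3 := by
      simp only [pow_succ, pow_zero]; group
    rwa [this, mul_inv_eq_one] at h
  have e2 : x * y * x = y⁻¹ * x⁻¹ * y⁻¹ := by
    have := h3 (x * y)
    have h : x * y * x * (y⁻¹ * x⁻¹ * y⁻¹)⁻¹ = (x * y) ^ 3 := by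
      simp only [pow_succ, pow_zero]; group
    rwa [this, mul_inv_eq_one] at h
  have e3 : y * y = y⁻¹ := eq_inv_of_mul_eq_one_left (by rw [← pow_two, ← pow_succ, h3])
  have e4 : y⁻¹ * y⁻¹ = y := by rw [← mul_inv_rev, e3, inv_inv]
  calc x * (y⁻¹ * x * y) = x * y⁻¹ * x * y := by group
    _ = y * x⁻¹ * (y * y) := by rw [e1]; group
    _ = (y⁻¹ * y⁻¹) * x⁻¹ * y⁻¹ := by rw [e3, e4]
    _ = y⁻¹ * (x * y * x) := by rw [e2]; group
    _ = y⁻¹ * x * y * x := by group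

theorem zpow_eq_of_pow_three {u : H} (h : u ^ 3 = 1) (n : ℤ) :
    u ^ n = 1 ∨ u ^ n = u ∨ u ^ n = u⁻¹ := by
  have h' : u ^ (3 : ℤ) = 1 := by exact_mod_cast h
  obtain ⟨q, hq⟩ : ∃ q, n = 3 * q ∨ n = 3 * q + 1 ∨ n = 3 * q + -1 := by
    rcases (by omega : n % 3 = 0 ∨ n % 3 = 1 ∨ n % 3 = 2) with h | h | h
    · exact ⟨n / 3, by omega⟩
    · exact ⟨n / 3, by omega⟩
    · exact ⟨n / 3 + 1, by omega⟩
  rcases hq with rfl | rfl | rfl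
  · left; rw [zpow_mul, h', one_zpow]
  · right; left; rw [zpow_add, zpow_mul, h', one_zpow, one_mul, zpow_one]
  · right; right; rw [zpow_add, zpow_mul, h', one_zpow, one_mul, zpow_neg_one]

variable {x y : H}

/-- The commutator is x⁻¹ times a conjugate of x, and also the inverse of a conjugate of y times y,
so it commutes with both generators. -/
theorem commute_commutator_of_pow_three (h3 : ∀ h : H, h ^ 3 = 1)
    (hxy : Subgroup.closure {x, y} = ⊤) (h : H) : Commute (x⁻¹ * y⁻¹ * x * y) h := by
  have hx : Commute (x⁻¹ * y⁻¹ * x * y) x := by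
    have := ((Commute.refl x).inv_right.mul_right (commute_conj_of_pow_three h3 x y)).symm
    simpa only [mul_assoc] using this
  have hy : Commute (x⁻¹ * y⁻¹ * x * y) y := by
    have := (((commute_conj_of_pow_three h3 y x).inv_right).mul_right (Commute.refl y)).symm
    have heq : (x⁻¹ * y * x)⁻¹ * y = x⁻¹ * y⁻¹ * x * y := by group
    rwa [heq] at this
  have hle : Subgroup.closure {x, y} ≤ Subgroup.centralizer {x⁻¹ * y⁻¹ * x * y} := by
    rw [Subgroup.closure_le]
    rintro z (rfl | rfl) <;> rw [SetLike.mem_coe, Subgroup.mem_centralizer_singleton_iff]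
    exacts [hx.symm.eq, hy.symm.eq]
  have := hle (hxy ▸ Subgroup.mem_top h)
  rw [Subgroup.mem_centralizer_singleton_iff] at this
  exact this.symm

/-- Normal form in a two-generator group of class two. -/
theorem exists_eq_zpow_mul_zpow_mul_zpow {c : H} (hc : ∀ h, Commute c h) (hxc : y⁻¹ * x * y = x * c)
    (hxy : Subgroup.closure {x, y} = ⊤) (h : H) : ∃ a b k : ℤ, h = x ^ a * y ^ b * c ^ k := by
  have hxc' : y * x * y⁻¹ = x * c⁻¹ := by
    have : x = y * x * y⁻¹ * c := by
      calc x = y * (y⁻¹ * x * y) * y⁻¹ := by group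
        _ = y * x * (c * y⁻¹) := by rw [hxc]; group
        _ = y * x * y⁻¹ * c := by rw [(hc y⁻¹).eq]; group
    rw [eq_mul_inv_iff_mul_eq, ← this]
  have h1 : ∀ a : ℤ, y * x ^ a = x ^ a * c ^ (-a) * y := by
    intro a
    rw [← mul_inv_eq_iff_eq_mul, ← conj_zpow, hxc', (hc x).symm.inv_right.mul_zpow, inv_zpow']
  have h2 : ∀ a : ℤ, y⁻¹ * x ^ a = x ^ a * c ^ a * y⁻¹ := by
    intro a
    rw [eq_mul_inv_iff_mul_eq, ← conj_zpow', hxc, (hc x).symm.mul_zpow]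
  have hcz : ∀ (k : ℤ) (z : H), c ^ k * z = z * c ^ k := fun k z => ((hc z).zpow_left k).eq
  have hh : h ∈ Subgroup.closure {x, y} := hxy ▸ Subgroup.mem_top h
  induction hh using Subgroup.closure_induction_left with
  | one => exact ⟨0, 0, 0, by simp⟩
  | mul_left u hu v hv ih =>
    obtain ⟨a, b, k, rfl⟩ := ih
    rcases hu with rfl | rfl
    · exact ⟨1 + a, b, k, by rw [zpow_add, zpow_one]; group⟩
    · refine ⟨a, 1 + b, -a + k, ?_⟩
      rw [← mul_assoc, ← mul_assoc, h1, mul_assoc (x ^ a), hcz, zpow_add, zpow_add c, zpow_one]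
      simp only [mul_assoc]
      rw [hcz (-a), mul_assoc, ← zpow_add, ← zpow_add, add_comm k]
  | inv_mul_cancel u hu v hv ih =>
    obtain ⟨a, b, k, rfl⟩ := ih
    rcases hu with rfl | rfl
    · exact ⟨-1 + a, b, k, by rw [zpow_add, zpow_neg_one]; group⟩
    · refine ⟨a, -1 + b, a + k, ?_⟩
      rw [← mul_assoc, ← mul_assoc, h2, mul_assoc (x ^ a), hcz, zpow_add, zpow_add c, zpow_neg_one]
      simp only [mul_assoc]
      rw [hcz a, mul_assoc, ← zpow_add, ← zpow_add, add_comm k]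

/-- In a group of exponent `3` generated by `x` and `y`, every generating set meets the conjugates
of `⟨x⟩`, `⟨y⟩` and `⟨x y⟩`, unless the group is cyclic. -/
theorem exists_conj_of_pow_three (h3 : ∀ h : H, h ^ 3 = 1) (hcyc : ¬ IsCyclic H)
    (hxy : Subgroup.closure {x, y} = ⊤) {S : Set H} (hS : Subgroup.closure S = ⊤) :
    ∃ t ∈ S, ∃ w ∈ [x, y, (x * y)⁻¹], w ≠ 1 ∧ ∃ (g : H) (n : ℤ), w = g⁻¹ * t ^ n * g := by
  have hnot : ∀ d : H, ¬ (x ∈ Subgroup.zpowers d ∧ y ∈ Subgroup.zpowers d) := by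
    rintro d ⟨hx, hy⟩
    refine hcyc ⟨d, fun h => ?_⟩
    have : Subgroup.closure {x, y} ≤ Subgroup.zpowers d := by
      rw [Subgroup.closure_le]
      rintro z (rfl | rfl)
      exacts [hx, hy]
    exact this (hxy ▸ Subgroup.mem_top h)
  have hne : ∀ w ∈ [x, y, (x * y)⁻¹], w ≠ 1 := by
    simp only [List.forall_mem_cons]
    refine ⟨?_, ?_, ?_, by simp⟩
    · rintro rfl
      exact hnot y ⟨one_mem _, Subgroup.mem_zpowers y⟩
    · rintro rfl
      exact hnot x ⟨Subgroup.mem_zpowers x, one_mem _⟩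
    · intro h1
      rw [inv_eq_one, mul_eq_one_iff_eq_inv'] at h1
      exact hnot x ⟨Subgroup.mem_zpowers x, h1 ▸ inv_mem (Subgroup.mem_zpowers x)⟩
  set c := x⁻¹ * y⁻¹ * x * y with hcdef
  have hc : ∀ h, Commute c h := commute_commutator_of_pow_three h3 hxy
  have hxc : y⁻¹ * x * y = x * c := by rw [hcdef]; group
  have hyc : x * y * x⁻¹ = y * c := by
    rw [← (hc y).eq, mul_inv_eq_iff_eq_mul, (hc y).eq, mul_assoc, (hc x).eq, ← hxc]
    group
  by_contra! hall
  -- Modulo the central c the exponents (a, b) of t, read mod 3, lie on one of four lines. On the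
  -- lines of x, y and x y, conjugation absorbs the factor c ^ k, so t or t⁻¹ is a conjugate of x, y
  -- or x y. Only the line of x y⁻¹ remains.
  have hK : ∀ t ∈ S, t ∈ Subgroup.closure {x * y⁻¹, c} := by
    intro t ht
    have hno : ∀ w ∈ [x, y, (x * y)⁻¹], ∀ (g : H) (n : ℤ), w ≠ g⁻¹ * t ^ n * g :=
      fun w hw => hall t ht w hw (hne w hw)
    have hd : x * y⁻¹ ∈ Subgroup.closure {x * y⁻¹, c} := Subgroup.subset_closure (by simp)
    have hcK : ∀ k : ℤ, c ^ k ∈ Subgroup.closure {x * y⁻¹, c} := fun k =>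
      zpow_mem (Subgroup.subset_closure (by simp)) k
    have hcx : ∀ k : ℤ, x * c ^ k = (y ^ k)⁻¹ * x * y ^ k := by
      intro k
      have := conj_zpow' x y⁻¹ k
      rw [show x⁻¹ * y⁻¹ * x = c * y⁻¹ by rw [hcdef]; group, (hc y⁻¹).mul_zpow, inv_zpow] at this
      calc x * c ^ k = x * (c ^ k * (y ^ k)⁻¹) * y ^ k := by group
        _ = (y ^ k)⁻¹ * x * y ^ k := by rw [this]; group
    have hcy : ∀ k : ℤ, y * c ^ k = x ^ k * y * (x ^ k)⁻¹ := by
      intro k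
      have := conj_zpow' y x k
      rw [hxc, (hc x).symm.mul_zpow, ← ((hc (x ^ k)).zpow_left k).eq] at this
      calc y * c ^ k = y * (c ^ k * x ^ k) * (x ^ k)⁻¹ := by group
        _ = x ^ k * y * (x ^ k)⁻¹ := by rw [this]; group
    obtain ⟨a, b, k, h⟩ := exists_eq_zpow_mul_zpow_mul_zpow hc hxc hxy t
    rcases zpow_eq_of_pow_three (h3 x) a with ha | ha | ha <;>
      rcases zpow_eq_of_pow_three (h3 y) b with hb | hb | hb <;> rw [ha, hb] at h
    · rw [h, one_mul, one_mul]
      exact hcK k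
    · refine absurd ?_ (hno y (by simp) (x ^ k) 1)
      rw [h, one_mul, hcy]; group
    · refine absurd ?_ (hno y (by simp) (x ^ (-k)) (-1))
      have : t⁻¹ = y * c ^ (-k) := by
        rw [h, one_mul, mul_inv_rev, inv_inv, ← zpow_neg, ((hc y).zpow_left _).eq]
      rw [zpow_neg_one, this, hcy]; group
    · refine absurd ?_ (hno x (by simp) ((y ^ k)⁻¹) 1)
      rw [h, mul_one, hcx]; group
    · refine absurd ?_ (hno (x * y)⁻¹ (by simp) ((y ^ k)⁻¹) (-1))
      have : t = (y ^ k)⁻¹ * (x * y) * y ^ k := by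
        rw [h, mul_assoc, ← ((hc y).zpow_left k).eq, ← mul_assoc, hcx]
        group
      rw [this]; group
    · rw [h]
      exact mul_mem hd (hcK k)
    · refine absurd ?_ (hno x (by simp) ((y ^ (-k))⁻¹) (-1))
      have : t⁻¹ = x * c ^ (-k) := by
        rw [h, mul_one, mul_inv_rev, inv_inv, ← zpow_neg, ((hc x).zpow_left _).eq]
      rw [zpow_neg_one, this, hcx]; group
    · have : t = (x * y⁻¹)⁻¹ * c ^ (k - 1) := by
        have hyx : y * x⁻¹ = x⁻¹ * y * c := by
          rw [mul_assoc, ← hyc]; group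
        rw [h, mul_inv_rev, inv_inv, hyx, mul_assoc _ c, ← zpow_one_add, add_sub_cancel]
      rw [this]
      exact mul_mem (inv_mem hd) (hcK _)
    · have : t⁻¹ = (y ^ (-k - 1))⁻¹ * (x * y) * y ^ (-k - 1) := by
        have hyx : y * x = x * y * c⁻¹ := by rw [hcdef]; group
        calc t⁻¹ = c ^ (-k) * (y * x) := by rw [h]; group
          _ = (x * y) * c ^ (-k - 1) := by
            rw [hyx, ((hc _).zpow_left _).eq, mul_assoc (x * y), ← zpow_neg_one c, ← zpow_add,
              show -1 + -k = -k - 1 by ring]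
          _ = x * c ^ (-k - 1) * y := by
            rw [mul_assoc, ← ((hc y).zpow_left _).eq, mul_assoc]
          _ = (y ^ (-k - 1))⁻¹ * (x * y) * y ^ (-k - 1) := by rw [hcx]; group
      refine absurd ?_ (hno (x * y)⁻¹ (by simp) ((y ^ (-k - 1))⁻¹) 1)
      rw [zpow_one, ← inv_inv t, this]; group
  have htop : Subgroup.closure {x * y⁻¹, c} = ⊤ := by
    rw [eq_top_iff, ← hS, Subgroup.closure_le]
    exact hK
  -- As c is central, ⟨x y⁻¹, c⟩ centralizes x y⁻¹. Being the whole group, it makes x and y commute;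
  -- then c = 1 and the group is cyclic.
  have hd : Commute y (x * y⁻¹) := by
    have hle : Subgroup.closure {x * y⁻¹, c} ≤ Subgroup.centralizer {x * y⁻¹} := by
      rw [Subgroup.closure_le]
      rintro z (rfl | rfl) <;> rw [SetLike.mem_coe, Subgroup.mem_centralizer_singleton_iff]
      exact (hc (x * y⁻¹)).eq
    have := hle (htop ▸ Subgroup.mem_top y)
    rwa [Subgroup.mem_centralizer_singleton_iff] at this
  have hc1 : c = 1 := by
    have : Commute y x := by
      have := hd.mul_right (Commute.refl y)
      rwa [inv_mul_cancel_right] at this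
    rw [hcdef, mul_assoc, ← this.eq]
    group
  refine hcyc ⟨x * y⁻¹, fun h => ?_⟩
  have hle : Subgroup.closure {x * y⁻¹, c} ≤ Subgroup.zpowers (x * y⁻¹) := by
    rw [Subgroup.closure_le, hc1]
    rintro z (rfl | rfl)
    exacts [Subgroup.mem_zpowers _, one_mem _]
  exact hle (htop ▸ Subgroup.mem_top h)

end ExponentThree

theorem IsSphericalSystem.closure_map_pair {G U : Type*} [Group G] [Group U] {f : G →* U}
    (hf : Function.Surjective f) {a b c : G} (hT : IsSphericalSystem [a, b, c]) :
    Subgroup.closure {f a, f b} = ⊤ ∧ f c = (f a * f b)⁻¹ := by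
  have hprod := hT.prod_eq_one
  simp only [List.prod_cons, List.prod_nil, mul_one, ← mul_assoc] at hprod
  have hfc : f c = (f a * f b)⁻¹ := by
    rw [eq_inv_iff_mul_eq_one, ← map_mul, ← map_mul, mul_eq_one_comm.1 hprod, map_one]
  refine ⟨?_, hfc⟩
  have ha : f a ∈ Subgroup.closure {f a, f b} := Subgroup.subset_closure (by simp)
  have hb : f b ∈ Subgroup.closure {f a, f b} := Subgroup.subset_closure (by simp)
  rw [eq_top_iff, ← hT.closure_map hf, Subgroup.closure_le]
  refine List.forall_mem_map.2 ?_
  simp only [List.forall_mem_cons]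
  exact ⟨ha, hb, hfc ▸ inv_mem (mul_mem ha hb), by simp⟩

namespace IsSemiPowAbelian

variable {e : ℕ} {G : Type*} [Group G] [Finite G]

theorem three_le_length {p : ℕ} [hp : Fact p.Prime] (hG : IsPGroup p G)
    (h : IsSemiPowAbelian p (e - 1) G) (hexp : Monoid.exponent G = p ^ e) {T₁ T₂ : List G}
    (hT : IsRamificationStructure T₁ T₂) : 3 ≤ T₁.length := by
  obtain ⟨f, hf, -⟩ := h.exists_surjective hexp (Or.inl rfl) (h.sq_le_ncard hG hexp hT)
  have h1 := (le_rank_multiplicative p 2).trans (Group.rank_le_of_surjective f hf)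
  have h2 := hT.spherical_left.rank_add_one_le hT.ne_nil
  omega

/-- A list of size 3 has images x, y, (x y)⁻¹ in G/K, which has exponent 3 and order at least 9, so
is not cyclic. The images of the other list generate G/K and so meet conjugates of these. G/K need
not be commutative, so counting lines in a plane would not do. -/
theorem four_le_length (hG : IsPGroup 3 G) (h : IsSemiPowAbelian 3 (e - 1) G)
    (hexp : Monoid.exponent G = 3 ^ e) {T₁ T₂ : List G} (hT : IsRamificationStructure T₁ T₂) :
    4 ≤ T₁.length := by
  have hsq := h.sq_le_ncard hG hexp hT
  refine (h.three_le_length hG hexp hT).lt_of_ne fun hlen => ?_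
  obtain ⟨a, b, c, rfl⟩ := List.length_eq_three.1 hlen.symm
  have hpow := h.quotient_pow_eq_one (hexp ▸ pow_dvd_pow 3 (by omega))
  have hsurj := QuotientGroup.mk'_surjective h.powKer
  obtain ⟨hab, hc⟩ := hT.spherical_left.closure_map_pair hsurj
  have hcyc : ¬ IsCyclic (G ⧸ h.powKer) := by
    intro hcyc
    rw [← h.card_quotient_powKer, ← IsCyclic.exponent_eq_card] at hsq
    have := Nat.le_of_dvd (by norm_num) (Monoid.exponent_dvd_of_forall_pow_eq_one hpow)
    omega
  obtain ⟨t, ht, w, hw, hw1, g, n, hwt⟩ := exists_conj_of_pow_three hpow hcyc hab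
    (hT.spherical_right.closure_map hsurj)
  obtain ⟨t, ht₂, rfl⟩ := List.mem_map.1 ht
  obtain ⟨g, rfl⟩ := hsurj g
  obtain ⟨v, hv, rfl⟩ : ∃ v ∈ [a, b, c], QuotientGroup.mk' h.powKer v = w := by
    rw [← hc] at hw
    exact List.mem_map.1 hw
  refine hw1 ((QuotientGroup.eq_one_iff v).2 (hT.pow_eq_one_of_conj hv ht₂ (g := g) (n := n) ?_))
  exact h.mk_eq_mk_iff.1 hwt

end IsSemiPowAbelian

/-! ### The main theorem -/

theorem IsSemiPowAbelian.conditions_of_isRamificationStructure {p e : ℕ} [hp : Fact p.Prime]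
    {G : Type*} [Group G] [Finite G] (hG : IsPGroup p G) (hexp : Monoid.exponent G = p ^ e)
    (h : IsSemiPowAbelian p (e - 1) G) {T₁ T₂ : List G} (hT : IsRamificationStructure T₁ T₂) :
    (Group.rank G + 1 ≤ T₁.length ∧ Group.rank G + 1 ≤ T₂.length) ∧
      (p = 3 → 4 ≤ T₁.length ∧ 4 ≤ T₂.length) ∧ (p = 2 → 5 ≤ T₁.length ∧ 5 ≤ T₂.length) ∧
      (p = 2 → (powSet p (e - 1) G).ncard = 2 ^ 3 → (T₁.length, T₂.length) ≠ (5, 5) ∧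
        (e = 1 → ¬(Odd T₁.length ∧ Odd T₂.length))) := by
  refine ⟨⟨hT.spherical_left.rank_add_one_le hT.ne_nil,
    hT.spherical_right.rank_add_one_le hT.symm.ne_nil⟩, ?_, ?_, ?_⟩
  · rintro rfl
    exact ⟨four_le_length hG h hexp hT, four_le_length hG h hexp hT.symm⟩
  · rintro rfl
    exact ⟨five_le_length h hG hexp hT, five_le_length h hG hexp hT.symm⟩
  · rintro rfl hcard
    have hcases := h.length_cases hexp hcard hT
    refine ⟨fun h5 => ?_, fun he => ?_⟩
    · rw [Prod.mk.injEq] at h5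
      omega
    · rw [← Nat.not_even_iff_odd, ← Nat.not_even_iff_odd]
      rintro ⟨h1, h2⟩
      exact hcases.elim (fun h => h1 (h.2 he)) fun h => h2 (h.2 he)

theorem IsSemiPowAbelian.mem_ramificationSizes_two {e : ℕ} {G : Type*} [Group G] [Finite G]
    (hG : IsPGroup 2 G) (hexp : Monoid.exponent G = 2 ^ e) (h : IsSemiPowAbelian 2 (e - 1) G)
    (hcard : 2 ^ 3 ≤ (powSet 2 (e - 1) G).ncard) {r₁ r₂ : ℕ} (hr₁ : Group.rank G + 1 ≤ r₁)
    (hr₂ : Group.rank G + 1 ≤ r₂) (h5₁ : 5 ≤ r₁) (h5₂ : 5 ≤ r₂)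
    (h8 : (powSet 2 (e - 1) G).ncard = 2 ^ 3 →
      (r₁, r₂) ≠ (5, 5) ∧ (e = 1 → ¬(Odd r₁ ∧ Odd r₂))) :
    (r₁, r₂) ∈ ramificationSizes G := by
  rcases Nat.even_or_odd r₂ with hr₂e | hr₂o
  · exact h.mem_ramificationSizes_of_even hG hexp hcard hr₁ hr₂ h5₁ h5₂ hr₂e
  rcases Nat.even_or_odd r₁ with hr₁e | hr₁o
  · exact ramificationSizes_symm.1
      (h.mem_ramificationSizes_of_even hG hexp hcard hr₂ hr₁ h5₂ h5₁ hr₁e)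
  obtain ⟨m, hm⟩ := h.exists_ncard_eq_pow hG
  rw [hm] at hcard
  rcases ((Nat.pow_le_pow_iff_right one_lt_two).1 hcard).eq_or_lt with rfl | hm4
  · obtain ⟨hne, h1⟩ := h8 hm
    have he1 : e ≠ 1 := fun he => h1 he ⟨hr₁o, hr₂o⟩
    have he : 2 ≤ e := by
      by_contra! he
      obtain rfl : e = 0 := by omega
      rw [pow_zero, Monoid.exp_eq_one_iff] at hexp
      have hle := Set.ncard_le_one_of_subsingleton (powSet 2 (0 - 1) G)
      omega
    -- Both sizes are odd, at least 5 and not both 5, so one of them is at least 7.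
    by_cases h7 : 7 ≤ r₂
    · exact h.mem_ramificationSizes_of_odd_odd hG hexp he hm hr₁ hr₂ h5₁ h7 hr₂o
    · refine ramificationSizes_symm.1
        (h.mem_ramificationSizes_of_odd_odd hG hexp he hm hr₂ hr₁ h5₂ ?_ hr₁o)
      obtain ⟨a, rfl⟩ := hr₁o
      obtain ⟨b, rfl⟩ := hr₂o
      by_contra! hlt
      exact hne (Prod.ext (by simp; omega) (by simp; omega))
  · exact h.mem_ramificationSizes_of_sixteen_le hG hexp
      (hm ▸ Nat.pow_le_pow_right two_pos hm4) hr₁ hr₂ h5₁ h5₂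

theorem IsSemiPowAbelian.eq_one_iff_nonempty_mulEquiv {e : ℕ} {G : Type*} [Group G] [Finite G]
    (hexp : Monoid.exponent G = 2 ^ e) (h : IsSemiPowAbelian 2 (e - 1) G)
    (hcard : (powSet 2 (e - 1) G).ncard = 2 ^ 3) :
    e = 1 ↔ Nonempty (G ≃* Multiplicative (Fin 3 → ZMod 2)) := by
  constructor
  · rintro rfl
    obtain ⟨f, hf, hker⟩ := h.exists_surjective hexp (Or.inr rfl) hcard.ge
    refine ⟨MulEquiv.ofBijective f ⟨fun x y hxy => ?_, hf⟩⟩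
    simpa using h.pow_eq_pow_of_apply_eq hcard hf hker hxy
  · rintro ⟨φ⟩
    have hdvd : 2 ^ e ∣ 2 ^ 1 := hexp ▸ Monoid.exponent_dvd_of_forall_pow_eq_one fun g =>
      φ.injective (by rw [map_pow, pow_one, multiplicative_zmod_two_sq, map_one])
    have hle := (Nat.pow_dvd_pow_iff_le_right one_lt_two).1 hdvd
    have he0 : e ≠ 0 := by
      rintro rfl
      rw [pow_zero, Monoid.exp_eq_one_iff] at hexp
      have := Set.ncard_le_one_of_subsingleton (powSet 2 (0 - 1) G)
      omega
    omega

theorem theoremA (p e : ℕ) (hp : p.Prime) (G : Type*) [Group G] [Finite G]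
    (hG : IsPGroup p G) (hexp : Monoid.exponent G = p ^ e)
    (hsemi : IsSemiPowAbelian p (e - 1) G) :
    ((∃ T₁ T₂ : List G, IsRamificationStructure T₁ T₂) ↔
      p ^ (if p = 2 then 3 else 2) ≤ (powSet p (e - 1) G).ncard) ∧
    (p ^ (if p = 2 then 3 else 2) ≤ (powSet p (e - 1) G).ncard →
      ∀ r₁ r₂ : ℕ, (r₁, r₂) ∈ ramificationSizes G ↔
        (Group.rank G + 1 ≤ r₁ ∧ Group.rank G + 1 ≤ r₂) ∧
        (p = 3 → 4 ≤ r₁ ∧ 4 ≤ r₂) ∧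
        (p = 2 → 5 ≤ r₁ ∧ 5 ≤ r₂) ∧
        (p = 2 → (powSet p (e - 1) G).ncard = 2 ^ 3 →
          (r₁, r₂) ≠ (5, 5) ∧ (e = 1 → ¬(Odd r₁ ∧ Odd r₂)))) ∧
    (p = 2 → (powSet p (e - 1) G).ncard = 2 ^ 3 →
      (e = 1 ↔ Nonempty (G ≃* Multiplicative (Fin 3 → ZMod 2)))) := by
  have : Fact p.Prime := ⟨hp⟩
  have sizes : p ^ (if p = 2 then 3 else 2) ≤ (powSet p (e - 1) G).ncard →
      ∀ r₁ r₂ : ℕ, (r₁, r₂) ∈ ramificationSizes G ↔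
        (Group.rank G + 1 ≤ r₁ ∧ Group.rank G + 1 ≤ r₂) ∧
        (p = 3 → 4 ≤ r₁ ∧ 4 ≤ r₂) ∧
        (p = 2 → 5 ≤ r₁ ∧ 5 ≤ r₂) ∧
        (p = 2 → (powSet p (e - 1) G).ncard = 2 ^ 3 →
          (r₁, r₂) ≠ (5, 5) ∧ (e = 1 → ¬(Odd r₁ ∧ Odd r₂))) := by
    intro hcard r₁ r₂
    constructor
    · rintro ⟨T₁, T₂, hT, h₁, h₂⟩
      obtain ⟨rfl, rfl⟩ : T₁.length = r₁ ∧ T₂.length = r₂ := ⟨h₁, h₂⟩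
      exact hsemi.conditions_of_isRamificationStructure hG hexp hT
    · rintro ⟨⟨hr₁, hr₂⟩, h3, h2, h8⟩
      by_cases hp2 : p = 2
      · subst hp2
        exact hsemi.mem_ramificationSizes_two hG hexp hcard hr₁ hr₂ (h2 rfl).1 (h2 rfl).2 (h8 rfl)
      · rw [if_neg hp2] at hcard
        obtain ⟨f, hf, -⟩ := hsemi.exists_surjective hexp (Or.inl rfl) hcard
        -- A quotient of rank 2 forces d ≥ 2, so condition (i) already gives sizes at least 3.
        have hrank := (le_rank_multiplicative p 2).trans (Group.rank_le_of_surjective f hf)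
        exact hsemi.mem_ramificationSizes_of_odd hp2 hG hexp hcard hr₁ hr₂ (by omega) (by omega) h3
  refine ⟨⟨?_, fun hcard => ?_⟩, sizes, ?_⟩
  · rintro ⟨T₁, T₂, hT⟩
    split_ifs with hp2
    · subst hp2
      exact hsemi.eight_le_ncard hG hexp hT
    · exact hsemi.sq_le_ncard hG hexp hT
  -- A pair of equal even sizes, larger than every bound, meets all the conditions at once.
  · have h5 : 2 * (Group.rank G + 5) ≠ 5 := by omega
    obtain ⟨T₁, T₂, hT, -⟩ := (sizes hcard (2 * (Group.rank G + 5)) (2 * (Group.rank G + 5))).2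
      ⟨by omega, by omega, by omega, fun _ _ => ⟨fun h => h5 (congrArg Prod.fst h),
        fun _ h => Nat.not_odd_iff_even.2 (even_two_mul _) h.1⟩⟩
    exact ⟨T₁, T₂, hT⟩
  · rintro rfl hcard
    exact hsemi.eq_one_iff_nonempty_mulEquiv hexp hcard
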